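/- **Setting.** Let $N\ge 1$. Consider $N$ bosonic modes with annihilation operators $\hat a_n$ on the Fock space $\mathcal H_N$, quadratures $\hat x_n=(\hat a_n+\hat a_n^\dagger)/\sqrt2$, $\hat p_n=(\hat a_n-\hat a_n^\dagger)/(\sqrt2\, i)$ and $\hat{\boldsymbol R}=(\hat x_1,\hat p_1,\dots,\hat x_N,\hat p_N)^T$, and coherent states $|\boldsymbol\alpha\rangle=\bigotimes_n|\alpha_n\rangle$, $\boldsymbol\alpha\in\mathbb C^N$. A state is a positive trace-one operator. It is *classical* if it is a mixture $\int|\boldsymbol\alpha\rangle\langle\boldsymbol\alpha|\,d\mu(\boldsymbol\alpha)$ of coherent states for some Borel probability measure $\mu$ on $\mathbb C^N$ (similarly for any other number of modes). For a unit vector $\psi$ let $\overline{\mathcal V}(\psi)=\frac1N\sum_{k=1}^{2N}\bigl(\langle\psi|\hat R^{(k)\,2}|\psi\rangle-\langle\psi|\hat R^{(k)}|\psi\rangle^2\bigr)\in[0,\infty]$, where $\langle\psi|\hat R^{(k)\,2}|\psi\rangle=\|\hat R^{(k)}\psi\|^2$, and the variance is $\infty$ if $\psi$ is not in the domain of $\hat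 R^{(k)}$. For a state $\rho$ let $$\mathcal Q(\rho)=\inf_{\{p_i,\psi_i\}}\sum_i p_i\,\overline{\mathcal V}(\psi_i)-1\in[0,\infty],$$ the infimum being over all finite or countably infinite decompositions $\rho=\sum_i p_i|\psi_i\rangle\langle\psi_i|$ with probabilities $p_i$ and unit vectors $\psi_i$. A *linear optical unitary* on finitely many modes is a unitary $\hat U_L$ for which there are a real orthogonal matrix $O$ and a real vector $d$ with $\hat U_L^\dagger\hat R^{(k)}\hat U_L=\sum_l O_{kl}\hat R^{(l)}+d_k$ for all $k$, on the common domain of the quadratures. A *linear optical map* is a map $\Phi_L(\rho)=\mathrm{Tr}_E[\hat U_L(\rho\otimes\sigma_E)\hat U_L^\dagger]$ with a linear optical unitary $\hat U_L$ and a classical state $\sigma_E$ of finitely many ancillary modes $E$. Bounded operators $\{\hat K_i\}$ on $\mathcal H_N$ form a *selective linear optical operation* if there are finite sets of ancillary modes $E,E'$, a classical state $\sigma_{EE'}$, a linear optical unitary $\hat U_L$ and orthonormal vectors $|i\rangle_{E'}$ in the Fock space of $E'$ such that $\mathrm{Tr}_E[\hat U_L(\rho\otimes\sigma_{EE'})\hat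 U_L^\dagger]=\sum_i\hat K_i\rho\hat K_i^\dagger\otimes|i\rangle_{E'}\langle i|$ for every state $\rho$. **Theorem.** $\inf_{\{p_i,\psi_i\}}\sum_i p_i\overline{\mathcal V}(\psi_i)\ge1$ for every state $\rho$, so that $\mathcal Q\ge 0$, and $\mathcal Q$ is a nonclassicality measure, that is: 1. (Faithfulness) For every state $\rho$, $\mathcal Q(\rho)=0$ if and only if $\rho$ is classical. 2. (a) (Weak monotonicity) $\mathcal Q(\rho)\ge\mathcal Q(\Phi_L(\rho))$ for every state $\rho$ and every linear optical map $\Phi_L$. (b) (Strong monotonicity) For every state $\rho$ and every selective linear optical operation $\{\hat K_i\}$, $\mathcal Q(\rho)\ge\sum_i p_i\,\mathcal Q(\rho_i)$, where $p_i=\mathrm{Tr}(\hat K_i\rho\hat K_i^\dagger)$ and $\rho_i=\hat K_i\rho\hat K_i^\dagger/p_i$ (terms with $p_i=0$ being omitted). 3. (Convexity) $\mathcal Q(\sum_i p_i\rho_i)\le\sum_i p_i\mathcal Q(\rho_i)$ for all finite or countable families of states $\rho_i$ and probabilities $p_i$. -/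

import Mathlib

open scoped ENNReal NNReal InnerProductSpace

noncomputable section

namespace BosonicModes

/-! ### Square-summable sequences, operators, trace -/

/-- The Hilbert space `ℓ²(X)` of square-summable families of complex numbers. -/
abbrev L2 (X : Type*) := lp (fun _ : X => ℂ) 2

/-- Bounded operators on `ℓ²(X)`. -/
abbrev Op (X : Type*) := L2 X →L[ℂ] L2 X

theorem memL2_iff {X : Type*} {f : X → ℂ} :
    Memℓp f 2 ↔ Summable fun x => ‖f x‖ ^ 2 := by
  rw [memℓp_gen_iff (by norm_num)]
  norm_num

theorem summable_sq {X : Type*} (f : L2 X) : Summable fun x => ‖f x‖ ^ 2 :=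
  memL2_iff.1 (lp.memℓp f)

theorem norm_sq_eq {X : Type*} (f : L2 X) : ‖f‖ ^ 2 = ∑' x, ‖f x‖ ^ 2 := by
  have h := lp.norm_rpow_eq_tsum (p := 2) (by norm_num) f
  norm_num at h
  exact h

open Classical in
/-- The standard orthonormal basis vector `|x⟩` of `ℓ²(X)`. -/
def basisVec {X : Type*} (x : X) : L2 X := lp.single 2 x 1

/-- The operator `|ψ⟩⟨ψ|`. -/
def ketbra {X : Type*} (ψ : L2 X) : Op X := InnerProductSpace.rankOne ℂ ψ ψ

/-- The trace `Tr T = ∑ ⟨x|T|x⟩` (used for trace-class operators). -/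
def trace {X : Type*} (T : Op X) : ℂ := ∑' x, ⟪basisVec x, T (basisVec x)⟫_ℂ

/-- Density operators: positive operators of trace one. -/
def IsDensityOperator {X : Type*} (ρ : Op X) : Prop :=
  ρ.IsPositive ∧ HasSum (fun x => ⟪basisVec x, ρ (basisVec x)⟫_ℂ) 1

/-! ### Tensor products and partial traces

A bijection `e : Z ≃ X × Y` identifies `ℓ²(Z)` with the Hilbert space tensor product
`ℓ²(X) ⊗ ℓ²(Y)`, the basis vector `|z⟩` being `|x⟩ ⊗ |y⟩` for `e z = (x, y)`. -/

theorem sum_slice_sq {X Y Z : Type*} (e : Z ≃ X × Y) (Ψ : L2 Z) :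
    (∀ y, Summable fun x => ‖Ψ (e.symm (x, y))‖ ^ 2) ∧
    (Summable fun y => ∑' x, ‖Ψ (e.symm (x, y))‖ ^ 2) ∧
    ∑' y, ∑' x, ‖Ψ (e.symm (x, y))‖ ^ 2 = ‖Ψ‖ ^ 2 := by
  set e' : Y × X ≃ Z := (Equiv.prodComm Y X).trans e.symm
  have h : Summable fun q : Y × X => ‖Ψ (e' q)‖ ^ 2 :=
    e'.summable_iff.2 (summable_sq Ψ)
  have h1 := (summable_prod_of_nonneg (fun q => by positivity)).1 h
  refine ⟨h1.1, h1.2, ?_⟩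
  rw [norm_sq_eq, ← e'.tsum_eq (fun z => ‖Ψ z‖ ^ 2), h.tsum_prod' h1.1]
  rfl

/-- The operator `1 ⊗ ⟨y| : ℓ²(X) ⊗ ℓ²(Y) → ℓ²(X)`. -/
def slice {X Y Z : Type*} (e : Z ≃ X × Y) (y : Y) : L2 Z →L[ℂ] L2 X :=
  LinearMap.mkContinuous
    { toFun := fun Ψ => ⟨fun x => Ψ (e.symm (x, y)), memL2_iff.2 ((sum_slice_sq e Ψ).1 y)⟩
      map_add' := fun _ _ => rfl
      map_smul' := fun _ _ => rfl } 1 (fun Ψ => by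
    rw [one_mul]
    refine le_of_sq_le_sq ?_ (norm_nonneg _)
    obtain ⟨_, h2, h3⟩ := sum_slice_sq e Ψ
    rw [norm_sq_eq, ← h3]
    exact h2.le_tsum y (fun y' _ => tsum_nonneg fun x => by positivity))

theorem slice_apply {X Y Z : Type*} (e : Z ≃ X × Y) (y : Y) (Ψ : L2 Z) (x : X) :
    slice e y Ψ x = Ψ (e.symm (x, y)) := rfl

theorem sum_norm_slice_sq {X Y Z : Type*} (e : Z ≃ X × Y) (Ψ : L2 Z) :
    HasSum (fun y => ‖slice e y Ψ‖ ^ 2) (‖Ψ‖ ^ 2) := by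
  obtain ⟨_, h2, h3⟩ := sum_slice_sq e Ψ
  have : (fun y => ‖slice e y Ψ‖ ^ 2) = fun y => ∑' x, ‖Ψ (e.symm (x, y))‖ ^ 2 := by
    funext y
    rw [norm_sq_eq]
    rfl
  rw [this, ← h3]
  exact h2.hasSum

theorem summable_extend {X Y Z : Type*} (e : Z ≃ X × Y) (S : Op X) (Ψ : L2 Z) :
    (Summable fun q : Y × X => ‖S (slice e q.1 Ψ) q.2‖ ^ 2) ∧
    ∑' q : Y × X, ‖S (slice e q.1 Ψ) q.2‖ ^ 2 ≤ (‖S‖ * ‖Ψ‖) ^ 2 := by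
  have hs := sum_norm_slice_sq e Ψ
  have hx : ∀ y, Summable fun x => ‖S (slice e y Ψ) x‖ ^ 2 := fun y =>
    summable_sq (S (slice e y Ψ))
  have hle : ∀ y, ∑' x, ‖S (slice e y Ψ) x‖ ^ 2 ≤ ‖S‖ ^ 2 * ‖slice e y Ψ‖ ^ 2 := by
    intro y
    rw [← norm_sq_eq (S (slice e y Ψ)), ← mul_pow]
    exact pow_le_pow_left₀ (norm_nonneg _) (S.le_opNorm _) 2
  have hm : Summable fun y => ‖S‖ ^ 2 * ‖slice e y Ψ‖ ^ 2 := hs.summable.mul_left (‖S‖ ^ 2)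
  have hsum : Summable fun y => ∑' x, ‖S (slice e y Ψ) x‖ ^ 2 :=
    Summable.of_nonneg_of_le (fun y => tsum_nonneg fun x => sq_nonneg _) hle hm
  have h : Summable fun q : Y × X => ‖S (slice e q.1 Ψ) q.2‖ ^ 2 :=
    (summable_prod_of_nonneg (fun q => sq_nonneg _)).2 ⟨hx, hsum⟩
  refine ⟨h, ?_⟩
  have h1 : ∑' q : Y × X, ‖S (slice e q.1 Ψ) q.2‖ ^ 2
      = ∑' y, ∑' x, ‖S (slice e y Ψ) x‖ ^ 2 := h.tsum_prod' hx
  have h2 : (‖S‖ * ‖Ψ‖) ^ 2 = ∑' y, ‖S‖ ^ 2 * ‖slice e y Ψ‖ ^ 2 := by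
    rw [tsum_mul_left, hs.tsum_eq, mul_pow]
  rw [h1, h2]
  exact hsum.tsum_le_tsum hle hm

/-- The operator `S ⊗ 1` on `ℓ²(X) ⊗ ℓ²(Y)`. -/
def extendOp {X Y Z : Type*} (e : Z ≃ X × Y) (S : Op X) : Op Z :=
  LinearMap.mkContinuous
    { toFun := fun Ψ => ⟨fun z => S (slice e (e z).2 Ψ) (e z).1, memL2_iff.2
        ((e.trans (Equiv.prodComm X Y)).summable_iff.2 (summable_extend e S Ψ).1)⟩
      map_add' := fun Ψ Ψ' => by
        ext z
        change S (slice e (e z).2 (Ψ + Ψ')) (e z).1 = _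
        rw [map_add, map_add]
        rfl
      map_smul' := fun c Ψ => by
        ext z
        change S (slice e (e z).2 (c • Ψ)) (e z).1 = _
        rw [map_smul, map_smul]
        rfl } ‖S‖ (fun Ψ => by
    refine le_of_sq_le_sq ?_ (by positivity)
    rw [norm_sq_eq]
    refine le_of_eq_of_le ?_ (summable_extend e S Ψ).2
    exact (e.trans (Equiv.prodComm X Y)).tsum_eq
      (fun q : Y × X => ‖S (slice e q.1 Ψ) q.2‖ ^ 2))

theorem extendOp_apply {X Y Z : Type*} (e : Z ≃ X × Y) (S : Op X) (Ψ : L2 Z) (z : Z) :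
    extendOp e S Ψ z = S (slice e (e z).2 Ψ) (e z).1 := rfl

/-- The tensor product operator `S ⊗ T = (S ⊗ 1)(1 ⊗ T)` on `ℓ²(X) ⊗ ℓ²(Y)`. -/
def tensorOp {X Y Z : Type*} (e : Z ≃ X × Y) (S : Op X) (T : Op Y) : Op Z :=
  extendOp e S ∘L extendOp (e.trans (Equiv.prodComm X Y)) T

/-- The partial trace over the second factor,
`Tr_Y T = ∑_y (1 ⊗ ⟨y|) T (1 ⊗ |y⟩)` (used for trace-class operators). -/
def partialTrace {X Y Z : Type*} (e : Z ≃ X × Y) (T : Op Z) : Op X :=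
  ∑' y, slice e y ∘L T ∘L (slice e y).adjoint

/-! ### Bosonic modes: Fock space, quadratures, coherent states

For a finite set `ι` of modes, the Fock space is `ℓ²(ι → ℕ)`, whose standard basis vectors are
the number states `|n⟩ = ⨂ |n_j⟩`. -/

/-- The Fock space of the modes `ι`. -/
abbrev Fock (ι : Type*) := L2 (ι → ℕ)

/-- Bounded operators on the Fock space. -/
abbrev FockOp (ι : Type*) := Op (ι → ℕ)

/-- The annihilation operator `a_j`, acting on arbitrary number-basis coefficients. -/
def annihilation {ι : Type*} [DecidableEq ι] (j : ι) (f : (ι → ℕ) → ℂ) : (ι → ℕ) → ℂ :=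
  fun n => (√((n j : ℝ) + 1) : ℂ) * f (n + Pi.single j 1)

/-- The creation operator `a_j†`, acting on arbitrary number-basis coefficients
(the prefactor vanishes if `n_j = 0`). -/
def creation {ι : Type*} [DecidableEq ι] (j : ι) (f : (ι → ℕ) → ℂ) : (ι → ℕ) → ℂ :=
  fun n => (√(n j : ℝ) : ℂ) * f (n - Pi.single j 1)

/-- The vector of quadratures: `x_j = (a_j + a_j†)/√2` for the index `inl j` and
`p_j = (a_j - a_j†)/(√2 i)` for the index `inr j`. As an unbounded operator, a quadrature has the
domain of all `ψ` in the Fock space whose image is square summable. -/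
def quadrature {ι : Type*} [DecidableEq ι] : ι ⊕ ι → ((ι → ℕ) → ℂ) → ((ι → ℕ) → ℂ)
  | Sum.inl j, f => fun n => (annihilation j f n + creation j f n) / (√2 : ℂ)
  | Sum.inr j, f => fun n => (annihilation j f n - creation j f n) / ((√2 : ℂ) * Complex.I)

/-- The variance `⟨R²⟩ - ⟨R⟩²` of a quadrature `R` in the pure state `ψ`, where
`⟨R²⟩ = ‖R ψ‖²`; it is `∞` if `ψ` is not in the domain of `R`. -/
def variance {ι : Type*} [DecidableEq ι] (ψ : Fock ι) (k : ι ⊕ ι) : ℝ≥0∞ :=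
  (∑' n, ENNReal.ofReal (‖quadrature k ψ n‖ ^ 2)) -
    ENNReal.ofReal ((∑' n, starRingEnd ℂ (ψ n) * quadrature k ψ n).re ^ 2)

/-- The mean quadrature variance per mode. -/
def meanVariance {ι : Type*} [Fintype ι] [DecidableEq ι] (ψ : Fock ι) : ℝ≥0∞ :=
  (∑ k : ι ⊕ ι, variance ψ k) / (Fintype.card ι : ℝ≥0∞)

theorem coherent_mem {ι : Type*} [Fintype ι] (α : ι → ℂ) :
    Memℓp (fun n : ι → ℕ => ∏ j, (Real.exp (-‖α j‖ ^ 2 / 2) : ℂ) * α j ^ n j /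
      (√((n j).factorial : ℝ) : ℂ)) 2 := by
  classical
  rw [memL2_iff]
  set g : ι → ℕ → ℝ := fun j m =>
    ‖(Real.exp (-‖α j‖ ^ 2 / 2) : ℂ) * α j ^ m / (√(m.factorial : ℝ) : ℂ)‖ ^ 2
  have hg : ∀ j, Summable (g j) := by
    intro j
    have h := (Real.summable_pow_div_factorial (‖α j‖ ^ 2)).mul_left
      (Real.exp (-‖α j‖ ^ 2 / 2) ^ 2)
    refine h.congr fun m => ?_
    simp only [g, norm_div, norm_mul, norm_pow, Complex.norm_real, Real.norm_eq_abs, div_pow,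
      mul_pow, sq_abs, Real.abs_exp]
    rw [Real.sq_sqrt (by positivity)]
    ring
  refine summable_of_sum_le (c := ∏ j, ∑' m, g j m) (fun n => by positivity) fun u => ?_
  set b : ι → Finset ℕ := fun j => u.image fun n => n j
  have hsub : u ⊆ Fintype.piFinset b := by
    intro n hn
    rw [Fintype.mem_piFinset]
    exact fun j => Finset.mem_image_of_mem _ hn
  calc _ ≤ ∑ n ∈ Fintype.piFinset b, ∏ j, g j (n j) := by
        refine (Finset.sum_le_sum_of_subset_of_nonneg hsub fun n _ _ => by positivity).trans
          (le_of_eq (Finset.sum_congr rfl fun n _ => ?_))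
        simp only [g, norm_prod, Finset.prod_pow]
    _ = ∏ j, ∑ m ∈ b j, g j m := by rw [Finset.prod_univ_sum]
    _ ≤ ∏ j, ∑' m, g j m :=
        Finset.prod_le_prod (fun j _ => Finset.sum_nonneg fun m _ => by positivity)
          fun j _ => (hg j).sum_le_tsum _ fun m _ => by positivity

/-- The coherent state `|α⟩ = ⨂_j e^{-|α_j|²/2} ∑_n α_j^n / √(n!) |n⟩`. -/
def coherent {ι : Type*} [Fintype ι] (α : ι → ℂ) : Fock ι := ⟨_, coherent_mem α⟩

/-- A state is classical if it is a statistical mixture `∫ |α⟩⟨α| dμ(α)` of coherent states with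
a probability measure `μ` (a nonnegative `P` function). -/
def IsClassical {ι : Type*} [Fintype ι] (ρ : FockOp ι) : Prop :=
  ∃ μ : MeasureTheory.Measure (ι → ℂ), MeasureTheory.IsProbabilityMeasure μ ∧
    ρ = ∫ α, ketbra (coherent α) ∂μ

/-! ### The convex roof -/

/-- `ρ = ∑ p_i |ψ_i⟩⟨ψ_i|` with probabilities `p_i` and unit vectors `ψ_i` (finite decompositions
are those with only finitely many nonzero `p_i`). -/
def IsPureDecomposition {X : Type*} (p : ℕ → ℝ≥0) (ψ : ℕ → L2 X) (ρ : Op X) : Prop :=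
  HasSum p 1 ∧ (∀ i, ‖ψ i‖ = 1) ∧ HasSum (fun i => ((p i : ℝ) : ℂ) • ketbra (ψ i)) ρ

/-- The convex roof of the mean quadrature variance. -/
def varianceRoof {ι : Type*} [Fintype ι] [DecidableEq ι] (ρ : FockOp ι) : ℝ≥0∞ :=
  ⨅ (p : ℕ → ℝ≥0) (ψ : ℕ → Fock ι) (_ : IsPureDecomposition p ψ ρ),
    ∑' i, (p i : ℝ≥0∞) * meanVariance (ψ i)

/-- The nonclassicality measure `Q`, with values in `[0, ∞]`. -/
def Q {ι : Type*} [Fintype ι] [DecidableEq ι] (ρ : FockOp ι) : ℝ≥0∞ := varianceRoof ρ - 1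

/-! ### Linear optics -/

/-- Linear optical unitaries: unitary operators `U` whose Heisenberg action on the quadratures is
an orthogonal transformation followed by a displacement,
`U† R_k U = ∑_l O_kl R_l + d_k` on the common domain of the quadratures. -/
def IsLinearOpticalUnitary {ι : Type*} [Fintype ι] [DecidableEq ι] (U : FockOp ι) : Prop :=
  U ∈ unitary (FockOp ι) ∧
  ∃ O ∈ Matrix.orthogonalGroup (ι ⊕ ι) ℝ, ∃ d : ι ⊕ ι → ℝ,
    ∀ (ψ : Fock ι) (Rψ : ι ⊕ ι → Fock ι),
      (∀ l, (Rψ l : (ι → ℕ) → ℂ) = quadrature l ψ) →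
      ∀ k, quadrature k (U ψ) =
        (U ((∑ l, (O k l : ℂ) • Rψ l) + (d k : ℂ) • ψ) : (ι → ℕ) → ℂ)

/-- The Fock space of `ι ⊕ κ` is the tensor product of the Fock spaces of `ι` and `κ`. -/
def modeSplit (ι κ : Type*) : (ι ⊕ κ → ℕ) ≃ (ι → ℕ) × (κ → ℕ) :=
  Equiv.sumArrowEquivProdArrow ι κ ℕ

/-- The linear optical map `ρ ↦ Tr_E [U (ρ ⊗ σ) U†]`. -/
def linearOpticalMap {A E : Type*} (U : FockOp (A ⊕ E)) (σ : FockOp E) (ρ : FockOp A) : FockOp A :=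
  partialTrace (modeSplit A E) (U * tensorOp (modeSplit A E) ρ σ * star U)

/-- The modes `A`, `E'`, `E`, grouped as the system `A E'` and the environment `E`. -/
def modeSplitAssoc (A E' E : Type*) :
    (A ⊕ (E' ⊕ E) → ℕ) ≃ (A ⊕ E' → ℕ) × (E → ℕ) :=
  ((Equiv.sumAssoc A E' E).symm.arrowCongr (Equiv.refl ℕ)).trans (modeSplit (A ⊕ E') E)

/-- Kraus operators `K_i` of a selective linear optical operation: there are a linear optical
unitary `U`, a classical ancilla state `σ` of the modes `E' E` and orthonormal vectors `|i⟩` of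
`E'` such that `Tr_E [U (ρ ⊗ σ) U†] = ∑_i K_i ρ K_i† ⊗ |i⟩⟨i|` for all states `ρ`. -/
def IsSelectiveLinearOptical {A κ : Type*} [Fintype A] [DecidableEq A] (K : κ → FockOp A) : Prop :=
  ∃ (M' M : ℕ) (U : FockOp (A ⊕ (Fin M' ⊕ Fin M))) (σ : FockOp (Fin M' ⊕ Fin M))
    (v : κ → Fock (Fin M')),
    IsLinearOpticalUnitary U ∧ IsClassical σ ∧ Orthonormal ℂ v ∧
    ∀ ρ : FockOp A, IsDensityOperator ρ →
      HasSum (fun i => tensorOp (modeSplit A (Fin M')) (K i * ρ * star (K i)) (ketbra (v i)))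
        (partialTrace (modeSplitAssoc A (Fin M') (Fin M))
          (U * tensorOp (modeSplit A (Fin M' ⊕ Fin M)) ρ σ * star U))

/-- The probability `p_i = Tr (K_i ρ K_i†)`. -/
def outcomeProb {X : Type*} (K ρ : Op X) : ℝ := (trace (K * ρ * star K)).re

/-- The conditional state `ρ_i = K_i ρ K_i† / p_i`, for `p_i ≠ 0`. -/
def outcomeState {X : Type*} (K ρ : Op X) : Op X :=
  ((outcomeProb K ρ)⁻¹ : ℂ) • (K * ρ * star K)

end BosonicModes

end

/-!
For a unit vector `ψ` and a centre `c ∈ ℂ^N`, put `D(c, ψ) = ∑_j ‖(a_j - c_j) ψ‖²`. Since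
`‖(x - d)ψ‖² + ‖(p - d')ψ‖² = 2 ‖(a - c)ψ‖² + ‖ψ‖²` whenever `c = (d + i d')/√2`, and since a
variance is the minimum of the centred second moments, `V̄(ψ) = 1 + (2/N) min_c D(c, ψ)`. Hence
`V̄ ≥ 1`, and `Q(ρ)` is `2/N` times the infimum of `∑_b D(c_b, χ_b)` over all ensembles
`ρ = ∑_b |χ_b⟩⟨χ_b|` of unnormalised vectors and all centres `c_b`
(`exists_isPureDecomposition_of_Q_lt`, `IsEnsemble.mul_Q_le`). As the centres may be chosen freely,
only upper bounds for `D` are needed when ensembles are transformed.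

*Monotonicity.* A linear optical unitary preserves `D` up to a change of the centre
(`IsLinearOpticalUnitary.exists_defect_eq`), `D` is additive on product vectors
(`defect_tensorVec`), and by Bessel's inequality it does not increase on average when the other
modes are measured (`IsModeSplitting.tsum_defect_bra_le`). So it remains to see that a classical
ancilla contributes arbitrarily little.

*Classical states have `Q = 0`.* For an ensemble `χ` of `T = ∫_C |α⟩⟨α| dμ(α)`, the sum
`∑_b D(c, χ_b)` depends only on `T` and equals `∫_C |α - c|² dμ(α)`. Cutting the phase space into
countably many cells `C` of small diameter, and taking any ensemble in each cell, gives
`IsClassical.exists_isEnsemble`.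

*States with `Q = 0` are classical.* Decompositions with `∑_i p_i D(c_i, ψ_i) → 0` define discrete
probability measures on pairs `(ψ, c)`, where the coefficients of `ψ` lie in the unit disc and `c`
in a compactification of phase space. By compactness they have a limit point, which still represents
the matrix elements of `ρ`. Almost surely for the limit, `ψ` is an eigenvector of all `a_j`, and it
has norm one because `ρ` has trace one; this excludes the points at infinity and leaves only
coherent states (`mul_conj_eq_of_eigenvector`, `isClassical_of_Q_eq_zero`).

*Convexity* follows by joining ensembles.
-/

open Filter Topology MeasureTheory

noncomputable section

namespace BosonicModes

/-! ### Ensembles of vectors -/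

theorem hasSum_sandwich {H K β : Type*} [NormedAddCommGroup H] [NormedSpace ℂ H]
    [NormedAddCommGroup K] [NormedSpace ℂ K] {f : β → H →L[ℂ] H} {T : H →L[ℂ] H}
    (h : HasSum f T) (B : H →L[ℂ] K) (A : K →L[ℂ] H) :
    HasSum (fun b => B ∘L f b ∘L A) (B ∘L T ∘L A) :=
  (h.mapL ((ContinuousLinearMap.compL ℂ K H H).flip A)).mapL (ContinuousLinearMap.compL ℂ K H K B)

theorem exists_sqrt_of_isPositive {H : Type*} [NormedAddCommGroup H] [InnerProductSpace ℂ H]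
    [CompleteSpace H] {T : H →L[ℂ] H} (hT : T.IsPositive) :
    ∃ S : H →L[ℂ] H, ∀ u v, ⟪S u, v⟫_ℂ = ⟪u, S v⟫_ℂ ∧ ⟪S u, S v⟫_ℂ = ⟪u, T v⟫_ℂ := by
  have hT0 : 0 ≤ T := (ContinuousLinearMap.nonneg_iff_isPositive T).2 hT
  have hS : CFC.sqrt T * CFC.sqrt T = T := CFC.sqrt_mul_sqrt_self T hT0
  have hSp : (CFC.sqrt T).IsPositive :=
    (ContinuousLinearMap.nonneg_iff_isPositive _).1 (CFC.sqrt_nonneg T)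
  have hsymm : ∀ u v, ⟪CFC.sqrt T u, v⟫_ℂ = ⟪u, CFC.sqrt T v⟫_ℂ := hSp.isSymmetric
  refine ⟨CFC.sqrt T, fun u v => ⟨hsymm u v, ?_⟩⟩
  conv_rhs => rw [← hS]
  exact hsymm u _

theorem hasSum_mul_of_summable_norm {R β γ : Type*} [NormedRing R] [CompleteSpace R]
    {f : β → R} {g : γ → R} {a b : R} (hf : HasSum f a) (hg : HasSum g b)
    (hf' : Summable fun i => ‖f i‖) (hg' : Summable fun i => ‖g i‖) :
    HasSum (fun q : β × γ => f q.1 * g q.2) (a * b) :=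
  hf.mul hg (summable_mul_of_summable_norm hf' hg')

theorem summable_norm_sq_mul {E F β γ : Type*} [NormedAddCommGroup E] [NormedAddCommGroup F]
    {f : β → E} {g : γ → F} (hf : Summable fun i => ‖f i‖ ^ 2) (hg : Summable fun i => ‖g i‖ ^ 2) :
    Summable fun q : β × γ => ‖f q.1‖ ^ 2 * ‖g q.2‖ ^ 2 :=
  hf.mul_of_nonneg hg (fun _ => sq_nonneg _) fun _ => sq_nonneg _

theorem norm_ketbra {X : Type*} (ψ : L2 X) : ‖ketbra ψ‖ = ‖ψ‖ ^ 2 := by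
  rw [ketbra, InnerProductSpace.norm_rankOne, sq]

theorem ketbra_apply {X : Type*} (ψ w : L2 X) : ketbra ψ w = ⟪ψ, w⟫_ℂ • ψ := rfl

theorem ketbra_map {X Y : Type*} (B : L2 X →L[ℂ] L2 Y) (ψ : L2 X) :
    ketbra (B ψ) = B ∘L ketbra ψ ∘L B.adjoint := by
  ext1 w
  simp [ketbra_apply, ContinuousLinearMap.adjoint_inner_right]

theorem ketbra_smul {X : Type*} (r : ℝ) (ψ : L2 X) :
    ketbra ((r : ℂ) • ψ) = ((r ^ 2 : ℝ) : ℂ) • ketbra ψ := by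
  ext1 w
  simp only [ketbra_apply, inner_smul_left, smul_apply, smul_smul,
    Complex.conj_ofReal]
  push_cast
  ring_nf

/-- The vectors `χ b` form an unnormalised ensemble of the operator `T`: their squared norms are
summable, and `T = ∑ |χ_b⟩⟨χ_b|`. -/
structure IsEnsemble {X β : Type*} (χ : β → L2 X) (T : Op X) : Prop where
  summable : Summable fun b => ‖χ b‖ ^ 2
  hasSum : HasSum (fun b => ketbra (χ b)) T

theorem summable_ketbra {X β : Type*} {χ : β → L2 X} (h : Summable fun b => ‖χ b‖ ^ 2) :
    Summable fun b => ketbra (χ b) :=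
  Summable.of_norm (by simpa only [norm_ketbra] using h)

namespace IsEnsemble

variable {X Y Z β γ : Type*} {χ : β → L2 X} {T : Op X}

theorem hasSum_inner (h : IsEnsemble χ T) (w w' : L2 X) :
    HasSum (fun b => ⟪w, χ b⟫_ℂ * ⟪χ b, w'⟫_ℂ) ⟪w, T w'⟫_ℂ := by
  have h1 : HasSum (fun b => ketbra (χ b) w') (T w') :=
    h.hasSum.mapL (ContinuousLinearMap.apply ℂ (L2 X) w')
  have h2 := h1.mapL (innerSL ℂ w)
  simpa [ketbra_apply, inner_smul_right, mul_comm] using h2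

theorem hasSum_inner_sq (h : IsEnsemble χ T) (w : L2 X) :
    HasSum (fun b => ‖⟪w, χ b⟫_ℂ‖ ^ 2) (⟪w, T w⟫_ℂ).re := by
  have h1 := Complex.hasSum_re (h.hasSum_inner w w)
  convert h1 using 2 with b
  rw [← inner_conj_symm (χ b) w, Complex.mul_conj, Complex.ofReal_re, Complex.normSq_eq_norm_sq]

theorem tsum_inner_sq (h : IsEnsemble χ T) (w : L2 X) :
    ∑' b, ‖⟪w, χ b⟫_ℂ‖ₑ ^ 2 = ENNReal.ofReal (⟪w, T w⟫_ℂ).re := by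
  rw [← (h.hasSum_inner_sq w).tsum_eq, ENNReal.ofReal_tsum_of_nonneg (fun b => by positivity)
    (h.hasSum_inner_sq w).summable]
  simp_rw [ENNReal.ofReal_pow (norm_nonneg _), ofReal_norm]

theorem map (h : IsEnsemble χ T) (B : L2 X →L[ℂ] L2 Y) :
    IsEnsemble (fun b => B (χ b)) (B ∘L T ∘L B.adjoint) where
  summable := by
    refine Summable.of_nonneg_of_le (fun b => by positivity) (fun b => ?_)
      (h.summable.mul_left (‖B‖ ^ 2))
    rw [← mul_pow]
    exact pow_le_pow_left₀ (norm_nonneg _) (B.le_opNorm _) 2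
  hasSum := by
    simp_rw [ketbra_map]
    exact hasSum_sandwich h.hasSum B _

/-- Gluing ensembles of operators `T k` yields an ensemble of `∑ T k`. -/
theorem hasSum_prod {κ : Type*} {χ : κ → β → L2 X} {T : κ → Op X}
    (h : ∀ k, IsEnsemble (χ k) (T k)) (hs : Summable fun q : κ × β => ‖χ q.1 q.2‖ ^ 2) :
    HasSum T (∑' k, T k) ∧ IsEnsemble (fun q : κ × β => χ q.1 q.2) (∑' k, T k) := by
  have h1 := (summable_ketbra hs).hasSum
  have h2 := h1.prod_fiberwise fun k => (h k).hasSum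
  rw [h2.tsum_eq]
  exact ⟨h2, hs, h1⟩

/-- The partial trace of an ensemble consists of all its slices. -/
theorem partialTrace (e : Z ≃ X × Y) {χ : β → L2 Z} {T : Op Z} (h : IsEnsemble χ T) :
    IsEnsemble (fun q : Y × β => slice e q.1 (χ q.2)) (partialTrace e T) := by
  refine (hasSum_prod (fun y => h.map (slice e y)) ?_).2
  have : Summable fun q : β × Y => ‖slice e q.2 (χ q.1)‖ ^ 2 := by
    refine (summable_prod_of_nonneg fun q => by positivity).2
      ⟨fun b => (sum_norm_slice_sq e (χ b)).summable, ?_⟩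
    simpa only [(sum_norm_slice_sq e _).tsum_eq] using h.summable
  exact (Equiv.prodComm Y β).summable_iff.2 this

end IsEnsemble

open Classical in
theorem inner_basisVec_left {X : Type*} (x : X) (ψ : L2 X) : ⟪basisVec x, ψ⟫_ℂ = ψ x := by
  have := lp.inner_single_left (𝕜 := ℂ) (G := fun _ : X => ℂ) x (1 : ℂ) ψ
  simpa [basisVec] using this

theorem norm_basisVec {X : Type*} (x : X) : ‖basisVec x‖ = 1 := by
  classical
  simp [basisVec]

theorem basisVec_apply_ne {X : Type*} {x y : X} (h : y ≠ x) : basisVec x y = 0 := by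
  classical
  exact lp.single_apply_ne (E := fun _ : X => ℂ) (p := 2) x (1 : ℂ) h

theorem orthonormal_basisVec {X : Type*} : Orthonormal ℂ (basisVec (X := X)) :=
  ⟨norm_basisVec, fun x _ h => (inner_basisVec_left x _).trans (basisVec_apply_ne h)⟩

theorem enorm_sq_eq {X : Type*} (ψ : L2 X) : ‖ψ‖ₑ ^ 2 = ∑' x, ‖ψ x‖ₑ ^ 2 := by
  rw [← ofReal_norm, ← ENNReal.ofReal_pow (norm_nonneg _), norm_sq_eq,
    ENNReal.ofReal_tsum_of_nonneg (fun b => by positivity) (summable_sq ψ)]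
  simp_rw [ENNReal.ofReal_pow (norm_nonneg _), ofReal_norm]

theorem ofReal_norm_sq {E : Type*} [SeminormedAddGroup E] (x : E) :
    ENNReal.ofReal (‖x‖ ^ 2) = ‖x‖ₑ ^ 2 := by
  rw [ENNReal.ofReal_pow (norm_nonneg _), ofReal_norm]

theorem summable_norm_sq_iff {E β : Type*} [SeminormedAddGroup E] {f : β → E} :
    (Summable fun b => ‖f b‖ ^ 2) ↔ ∑' b, ‖f b‖ₑ ^ 2 ≠ ⊤ := by
  simp_rw [← ofReal_norm_sq]
  refine ⟨fun h => h.tsum_ofReal_ne_top, fun h => ?_⟩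
  have := ENNReal.summable_toReal h
  simpa [ENNReal.toReal_ofReal, sq_nonneg] using this

theorem ofReal_tsum_norm_sq {E β : Type*} [SeminormedAddGroup E] {f : β → E}
    (h : Summable fun b => ‖f b‖ ^ 2) :
    ENNReal.ofReal (∑' b, ‖f b‖ ^ 2) = ∑' b, ‖f b‖ₑ ^ 2 := by
  rw [ENNReal.ofReal_tsum_of_nonneg (fun b => by positivity) h]
  simp_rw [ofReal_norm_sq]

namespace IsEnsemble

variable {X Y Z β γ : Type*} {χ : β → L2 X} {T : Op X}

theorem hasSum_diag (h : IsEnsemble χ T) :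
    HasSum (fun x => ⟪basisVec x, T (basisVec x)⟫_ℂ) ((∑' b, ‖χ b‖ ^ 2 : ℝ) : ℂ) := by
  have hs : Summable fun q : β × X => ‖χ q.1 q.2‖ ^ 2 := by
    refine (summable_prod_of_nonneg fun q => by positivity).2 ⟨fun b => summable_sq (χ b), ?_⟩
    simpa only [← norm_sq_eq] using h.summable
  have h1 : HasSum (fun q : β × X => ((‖χ q.1 q.2‖ ^ 2 : ℝ) : ℂ)) ((∑' b, ‖χ b‖ ^ 2 : ℝ) : ℂ) := by
    rw [Complex.hasSum_ofReal]
    have := hs.hasSum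
    rwa [hs.tsum_prod' (fun b => summable_sq (χ b)), tsum_congr fun b => (norm_sq_eq (χ b)).symm]
      at this
  refine ((Equiv.prodComm X β).hasSum_iff.2 h1).prod_fiberwise fun x => ?_
  have h2 := h.hasSum_inner (basisVec x) (basisVec x)
  convert h2 using 2 with b
  rw [← inner_conj_symm (χ b), inner_basisVec_left, Complex.mul_conj, Complex.normSq_eq_norm_sq]
  rfl

theorem trace_eq (h : IsEnsemble χ T) : trace T = ((∑' b, ‖χ b‖ ^ 2 : ℝ) : ℂ) :=
  h.hasSum_diag.tsum_eq

theorem hasSum_norm_sq_of_isDensityOperator (h : IsEnsemble χ T) (hT : IsDensityOperator T) :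
    HasSum (fun b => ‖χ b‖ ^ 2) 1 := by
  have := h.hasSum_diag.unique hT.2
  have h1 : ∑' b, ‖χ b‖ ^ 2 = 1 := by exact_mod_cast this
  rw [← h1]
  exact h.summable.hasSum

end IsEnsemble

/-- A positive operator with finite trace has an ensemble, namely `√T |x⟩`. -/
theorem exists_isEnsemble_of_isPositive {X : Type*} {T : Op X} (hT : T.IsPositive)
    (hs : Summable fun x => (⟪basisVec x, T (basisVec x)⟫_ℂ).re) :
    ∃ χ : X → L2 X, IsEnsemble χ T := by
  obtain ⟨S, hS⟩ := exists_sqrt_of_isPositive hT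
  have hsymm : ∀ u v, ⟪S u, v⟫_ℂ = ⟪u, S v⟫_ℂ := fun u v => (hS u v).1
  have hform : ∀ u v, ⟪S u, S v⟫_ℂ = ⟪u, T v⟫_ℂ := fun u v => (hS u v).2
  have hs' : Summable fun x => ‖S (basisVec x)‖ ^ 2 := by
    refine hs.congr fun x => ?_
    rw [← hform, inner_self_eq_norm_sq_to_K]
    norm_cast
  refine ⟨fun x => S (basisVec x), hs', ?_⟩
  have h := (summable_ketbra hs').hasSum
  have h2 : IsEnsemble (fun x => S (basisVec x)) _ := ⟨hs', h⟩
  convert h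
  refine ContinuousLinearMap.ext fun v => ext_inner_left ℂ fun u => ?_
  refine HasSum.unique ?_ (h2.hasSum_inner u v)
  rw [← hform]
  have hterm : ∀ x, ⟪u, S (basisVec x)⟫_ℂ * ⟪S (basisVec x), v⟫_ℂ = ⟪S u x, S v x⟫_ℂ := fun x => by
    rw [hsymm, ← hsymm u, inner_basisVec_left, ← inner_conj_symm (S u), inner_basisVec_left]
    simp [mul_comm]
  simp_rw [hterm]
  exact lp.hasSum_inner (𝕜 := ℂ) (S u) (S v)

/-! ### Tensor products of vectors and ensembles -/

section Tensor

variable {X Y Z : Type*} (e : Z ≃ X × Y)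

/-- The operator `1 ⊗ ⟨w| : ℓ²(X) ⊗ ℓ²(Y) → ℓ²(X)`. -/
def bra (w : L2 Y) : L2 Z →L[ℂ] L2 X :=
  have hle : ∀ Ψ x, ‖⟪w, slice (e.trans (Equiv.prodComm X Y)) x Ψ⟫_ℂ‖ ^ 2 ≤
      ‖w‖ ^ 2 * ‖slice (e.trans (Equiv.prodComm X Y)) x Ψ‖ ^ 2 := fun Ψ x => by
    rw [← mul_pow]
    exact pow_le_pow_left₀ (norm_nonneg _) (norm_inner_le_norm _ _) 2
  have hs : ∀ Ψ, HasSum (fun x => ‖w‖ ^ 2 * ‖slice (e.trans (Equiv.prodComm X Y)) x Ψ‖ ^ 2)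
      (‖w‖ ^ 2 * ‖Ψ‖ ^ 2) := fun Ψ => (sum_norm_slice_sq _ Ψ).mul_left _
  LinearMap.mkContinuous
    { toFun := fun Ψ => ⟨fun x => ⟪w, slice (e.trans (Equiv.prodComm X Y)) x Ψ⟫_ℂ,
        memL2_iff.2 (Summable.of_nonneg_of_le (fun x => by positivity) (hle Ψ) (hs Ψ).summable)⟩
      map_add' := fun Ψ Ψ' => by
        ext x
        exact (congrArg _ (map_add _ Ψ Ψ')).trans (inner_add_right _ _ _)
      map_smul' := fun c Ψ => by
        ext x
        exact (congrArg _ (map_smul _ c Ψ)).trans (inner_smul_right _ _ _) } ‖w‖ (fun Ψ => by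
    refine le_of_sq_le_sq ?_ (by positivity)
    rw [norm_sq_eq, mul_pow, ← (hs Ψ).tsum_eq]
    exact Summable.tsum_le_tsum (hle Ψ)
      (Summable.of_nonneg_of_le (fun x => by positivity) (hle Ψ) (hs Ψ).summable) (hs Ψ).summable)

theorem bra_apply (w : L2 Y) (Ψ : L2 Z) (x : X) :
    bra e w Ψ x = ⟪w, slice (e.trans (Equiv.prodComm X Y)) x Ψ⟫_ℂ := rfl

theorem slice_eq_bra (y : Y) : slice e y = bra e (basisVec y) := by
  ext Ψ x
  rw [bra_apply, inner_basisVec_left]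
  rfl

theorem hasSum_mul_sq (ψ : L2 X) (φ : L2 Y) :
    HasSum (fun z => ‖ψ (e z).1 * φ (e z).2‖ ^ 2) (‖ψ‖ ^ 2 * ‖φ‖ ^ 2) := by
  refine (e.hasSum_iff (f := fun q : X × Y => ‖ψ q.1 * φ q.2‖ ^ 2)).2 ?_
  simp_rw [norm_mul, mul_pow]
  rw [norm_sq_eq ψ, norm_sq_eq φ]
  exact (summable_sq ψ).hasSum.mul (summable_sq φ).hasSum
    (summable_norm_sq_mul (summable_sq ψ) (summable_sq φ))

/-- The vector `ψ ⊗ φ`. -/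
def tensorVec (ψ : L2 X) (φ : L2 Y) : L2 Z :=
  ⟨fun z => ψ (e z).1 * φ (e z).2, memL2_iff.2 (hasSum_mul_sq e ψ φ).summable⟩

theorem tensorVec_apply (ψ : L2 X) (φ : L2 Y) (z : Z) :
    tensorVec e ψ φ z = ψ (e z).1 * φ (e z).2 := rfl

theorem norm_tensorVec_sq (ψ : L2 X) (φ : L2 Y) :
    ‖tensorVec e ψ φ‖ ^ 2 = ‖ψ‖ ^ 2 * ‖φ‖ ^ 2 := by
  rw [norm_sq_eq]
  exact (hasSum_mul_sq e ψ φ).tsum_eq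

theorem inner_bra (w : L2 Y) (ψ : L2 X) (Ψ : L2 Z) :
    ⟪ψ, bra e w Ψ⟫_ℂ = ⟪tensorVec e ψ w, Ψ⟫_ℂ := by
  have h1 := lp.hasSum_inner (𝕜 := ℂ) (tensorVec e ψ w) Ψ
  have h2 := e.symm.hasSum_iff.2 h1
  refine HasSum.unique (lp.hasSum_inner (𝕜 := ℂ) ψ (bra e w Ψ)) (h2.prod_fiberwise fun x => ?_)
  have h3 := (lp.hasSum_inner (𝕜 := ℂ) w (slice (e.trans (Equiv.prodComm X Y)) x Ψ)).mul_right
    (starRingEnd ℂ (ψ x))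
  have hterm : ∀ y, ⟪w y, slice (e.trans (Equiv.prodComm X Y)) x Ψ y⟫_ℂ * starRingEnd ℂ (ψ x) =
      ⟪tensorVec e ψ w (e.symm (x, y)), Ψ (e.symm (x, y))⟫_ℂ := fun y => by
    have h4 : slice (e.trans (Equiv.prodComm X Y)) x Ψ y = Ψ (e.symm (x, y)) := rfl
    rw [h4, tensorVec_apply]
    simp only [Equiv.apply_symm_apply, RCLike.inner_apply, map_mul]
    ring
  simp_rw [hterm] at h3
  exact h3

theorem adjoint_bra (w : L2 Y) (ψ : L2 X) : (bra e w).adjoint ψ = tensorVec e ψ w :=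
  ext_inner_right ℂ fun Ψ => by rw [ContinuousLinearMap.adjoint_inner_left, inner_bra]

theorem bra_tensorVec (w v : L2 Y) (ψ : L2 X) :
    bra e w (tensorVec e ψ v) = ⟪w, v⟫_ℂ • ψ := by
  ext x
  have h : slice (e.trans (Equiv.prodComm X Y)) x (tensorVec e ψ v) = ψ x • v := by
    ext y
    change ψ _ * v _ = ψ x * v y
    simp
  rw [bra_apply, h, inner_smul_right]
  simp [mul_comm]

theorem tensorOp_ketbra_apply (S : Op X) (w : L2 Y) (Ψ : L2 Z) :
    tensorOp e S (ketbra w) Ψ = tensorVec e (S (bra e w Ψ)) w := by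
  ext z
  have h : slice e (e z).2 (extendOp (e.trans (Equiv.prodComm X Y)) (ketbra w) Ψ) =
      w (e z).2 • bra e w Ψ := by
    ext x
    rw [slice_apply, extendOp_apply]
    simp [ketbra_apply, bra_apply, mul_comm]
  change extendOp e S (extendOp (e.trans (Equiv.prodComm X Y)) (ketbra w) Ψ) z = _
  rw [extendOp_apply, h, map_smul, tensorVec_apply]
  simp [mul_comm]

theorem tensorOp_ketbra_ketbra (ψ : L2 X) (φ : L2 Y) :
    tensorOp e (ketbra ψ) (ketbra φ) = ketbra (tensorVec e ψ φ) := by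
  ext1 Ψ
  rw [tensorOp_ketbra_apply, ketbra_apply, ketbra_apply, inner_bra]
  ext z
  simp [tensorVec_apply, mul_assoc]

theorem bra_tensorOp_ketbra_adjoint (S : Op X) (w v : L2 Y) :
    bra e v ∘L tensorOp e S (ketbra w) ∘L (bra e v).adjoint = (‖⟪v, w⟫_ℂ‖ ^ 2 : ℂ) • S := by
  ext1 ψ
  simp only [ContinuousLinearMap.comp_apply, adjoint_bra, tensorOp_ketbra_apply, bra_tensorVec,
    map_smul, smul_smul, smul_apply]
  rw [← inner_conj_symm w v, Complex.mul_conj, Complex.normSq_eq_norm_sq]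
  norm_cast

theorem norm_extendOp_le (S : Op X) : ‖extendOp e S‖ ≤ ‖S‖ :=
  LinearMap.mkContinuous_norm_le _ (norm_nonneg _) _

/-- The map `S ↦ S ⊗ 1` as a continuous linear map. -/
def extendOpL : Op X →L[ℂ] Op Z :=
  LinearMap.mkContinuous
    { toFun := extendOp e
      map_add' := fun _ _ => rfl
      map_smul' := fun _ _ => rfl } 1 fun S => by
    rw [one_mul]
    exact norm_extendOp_le e S

theorem hasSum_tensorOp {β γ : Type*} {χ : β → L2 X} {φ : γ → L2 Y} {S : Op X} {T : Op Y}
    (hS : IsEnsemble χ S) (hT : IsEnsemble φ T) :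
    HasSum (fun q : β × γ => tensorOp e (ketbra (χ q.1)) (ketbra (φ q.2))) (tensorOp e S T) := by
  have h1 : HasSum (fun b => extendOp e (ketbra (χ b))) (extendOp e S) :=
    hS.hasSum.mapL (extendOpL e)
  have h2 : HasSum (fun c => extendOp (e.trans (Equiv.prodComm X Y)) (ketbra (φ c)))
    (extendOp (e.trans (Equiv.prodComm X Y)) T) :=
    hT.hasSum.mapL (extendOpL (e.trans (Equiv.prodComm X Y)))
  have h3 : Summable fun b => ‖extendOp e (ketbra (χ b))‖ :=
    Summable.of_nonneg_of_le (fun _ => norm_nonneg _)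
      (fun b => (norm_extendOp_le e _).trans_eq (norm_ketbra _)) hS.summable
  have h4 : Summable fun c => ‖extendOp (e.trans (Equiv.prodComm X Y)) (ketbra (φ c))‖ :=
    Summable.of_nonneg_of_le (fun _ => norm_nonneg _)
      (fun b => (norm_extendOp_le _ _).trans_eq (norm_ketbra _)) hT.summable
  have h5 := hasSum_mul_of_summable_norm h1 h2 h3 h4
  exact h5

theorem IsEnsemble.tensor {β γ : Type*} {χ : β → L2 X} {φ : γ → L2 Y} {S : Op X} {T : Op Y}
    (hS : IsEnsemble χ S) (hT : IsEnsemble φ T) :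
    IsEnsemble (fun q : β × γ => tensorVec e (χ q.1) (φ q.2)) (tensorOp e S T) := by
  have h1 := hasSum_tensorOp e hS hT
  simp_rw [tensorOp_ketbra_ketbra] at h1
  have h2 : Summable fun q : β × γ => ‖tensorVec e (χ q.1) (φ q.2)‖ ^ 2 := by
    simp_rw [norm_tensorVec_sq]
    exact summable_norm_sq_mul hS.summable hT.summable
  exact ⟨h2, h1⟩

end Tensor

/-! ### Centred second moments of mode operators -/

/-- The real centres of the quadratures belonging to the complex centres `c` of the annihilation
operators: `c_j = (x_j + i p_j) / √2`. -/
def quadratureCenter {ι : Type*} (c : ι → ℂ) : ι ⊕ ι → ℝ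
  | Sum.inl j => √2 * (c j).re
  | Sum.inr j => √2 * (c j).im

theorem exists_quadratureCenter_eq {ι : Type*} (d : ι ⊕ ι → ℝ) : ∃ c, quadratureCenter c = d := by
  refine ⟨fun j => ⟨d (Sum.inl j) / √2, d (Sum.inr j) / √2⟩, funext fun k => ?_⟩
  rcases k with j | j <;> simp only [quadratureCenter] <;> field_simp

section Defect

variable {ι : Type*} [DecidableEq ι]

/-- The second moment `‖(a_j - c) f‖²` of the annihilation operator centred at `c`, as an element
of `[0, ∞]`. -/
def modeDefect (c : ℂ) (j : ι) (f : (ι → ℕ) → ℂ) : ℝ≥0∞ :=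
  ∑' n, ‖annihilation j f n - c * f n‖ₑ ^ 2

/-- The second moment `‖(R_k - d) f‖²` of a quadrature centred at `d`. -/
def quadratureDefect (d : ℝ) (k : ι ⊕ ι) (f : (ι → ℕ) → ℂ) : ℝ≥0∞ :=
  ∑' n, ‖quadrature k f n - d * f n‖ₑ ^ 2

/-- The total `∑_j ‖(a_j - c_j) f‖²`. It vanishes precisely on the multiples of the coherent state
`|c⟩`, and its minimum over `c` for a unit vector is half the excess of the total quadrature
variance over the number of modes. -/
def defect [Fintype ι] (c : ι → ℂ) (f : (ι → ℕ) → ℂ) : ℝ≥0∞ := ∑ j, modeDefect (c j) j f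

/-- A function with finite square sum as an element of `ℓ²`. -/
def toL2 {X : Type*} (f : X → ℂ) (h : ∑' x, ‖f x‖ₑ ^ 2 ≠ ⊤) : L2 X :=
  ⟨f, memL2_iff.2 (summable_norm_sq_iff.2 h)⟩

theorem enorm_sub_sq_le {E : Type*} [SeminormedAddCommGroup E] (a b : E) :
    ‖a - b‖ₑ ^ 2 ≤ 2 * ‖a‖ₑ ^ 2 + 2 * ‖b‖ₑ ^ 2 := by
  have h : ‖a - b‖ ^ 2 ≤ 2 * ‖a‖ ^ 2 + 2 * ‖b‖ ^ 2 := by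
    have := pow_le_pow_left₀ (norm_nonneg _) (norm_sub_le a b) 2
    nlinarith [sq_nonneg (‖a‖ - ‖b‖)]
  have := ENNReal.ofReal_le_ofReal h
  rw [ENNReal.ofReal_add (by positivity) (by positivity), ENNReal.ofReal_mul (by norm_num),
    ENNReal.ofReal_mul (by norm_num)] at this
  simpa [ofReal_norm_sq] using this

theorem enorm_add_sq_le {E : Type*} [SeminormedAddCommGroup E] (a b : E) :
    ‖a + b‖ₑ ^ 2 ≤ 2 * ‖a‖ₑ ^ 2 + 2 * ‖b‖ₑ ^ 2 := by
  simpa using enorm_sub_sq_le a (-b)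

theorem tsum_sub_mul_ne_top_iff {X : Type*} (g : X → ℂ) (c : ℂ) (ψ : L2 X) :
    ∑' x, ‖g x - c * ψ x‖ₑ ^ 2 ≠ ⊤ ↔ ∑' x, ‖g x‖ₑ ^ 2 ≠ ⊤ := by
  have hψ : ∑' x, 2 * ‖c * ψ x‖ₑ ^ 2 ≠ ⊤ := by
    simp_rw [enorm_mul, mul_pow]
    rw [ENNReal.tsum_mul_left, ENNReal.tsum_mul_left, ← enorm_sq_eq]
    finiteness
  constructor <;> intro h
  · refine ne_top_of_le_ne_top
      (ENNReal.add_ne_top.2 ⟨ENNReal.mul_ne_top ENNReal.ofNat_ne_top h, hψ⟩)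
      ?_ (b := 2 * (∑' x, ‖g x - c * ψ x‖ₑ ^ 2) + ∑' x, 2 * ‖c * ψ x‖ₑ ^ 2)
    rw [← ENNReal.tsum_mul_left, ← ENNReal.tsum_add]
    refine ENNReal.tsum_le_tsum fun x => ?_
    simpa using enorm_add_sq_le (g x - c * ψ x) (c * ψ x)
  · refine ne_top_of_le_ne_top
      (ENNReal.add_ne_top.2 ⟨ENNReal.mul_ne_top ENNReal.ofNat_ne_top h, hψ⟩)
      ?_ (b := 2 * (∑' x, ‖g x‖ₑ ^ 2) + ∑' x, 2 * ‖c * ψ x‖ₑ ^ 2)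
    rw [← ENNReal.tsum_mul_left, ← ENNReal.tsum_add]
    exact ENNReal.tsum_le_tsum fun x => enorm_sub_sq_le _ _

theorem tsum_shift (j : ι) {F : (ι → ℕ) → ℝ≥0∞} (hF : ∀ n, n j = 0 → F n = 0) :
    ∑' n : ι → ℕ, F (n + Pi.single j 1) = ∑' n, F n := by
  refine (add_left_injective (Pi.single j 1 : ι → ℕ)).tsum_eq fun n hn => ?_
  refine ⟨n - Pi.single j 1, funext fun i => ?_⟩
  rcases eq_or_ne i j with rfl | hij
  · have : n i ≠ 0 := fun h => hn (hF n h)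
    simp
    omega
  · simp [hij]

theorem hasSum_shift (j : ι) {F : (ι → ℕ) → ℂ} (hF : ∀ n, n j = 0 → F n = 0) {a : ℂ} :
    HasSum (fun n : ι → ℕ => F (n + Pi.single j 1)) a ↔ HasSum F a := by
  refine (add_left_injective (Pi.single j 1 : ι → ℕ)).hasSum_iff (f := F) fun n hn => ?_
  by_contra hne
  refine hn ⟨n - Pi.single j 1, funext fun i => ?_⟩
  rcases eq_or_ne i j with rfl | hij
  · have : n i ≠ 0 := fun h => hne (hF n h)
    simp
    omega
  · simp [hij]

theorem enorm_sqrt_mul_sq (r : ℝ) (hr : 0 ≤ r) (z : ℂ) :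
    ‖(√r : ℂ) * z‖ₑ ^ 2 = ENNReal.ofReal r * ‖z‖ₑ ^ 2 := by
  rw [enorm_mul, mul_pow, ← ofReal_norm_sq (√r : ℂ), Complex.norm_real, Real.norm_eq_abs, sq_abs,
    Real.sq_sqrt hr]

theorem tsum_annihilation_sq (j : ι) (f : (ι → ℕ) → ℂ) :
    ∑' n, ‖annihilation j f n‖ₑ ^ 2 = ∑' n : ι → ℕ, (n j : ℝ≥0∞) * ‖f n‖ₑ ^ 2 := by
  rw [← tsum_shift j (F := fun n => (n j : ℝ≥0∞) * ‖f n‖ₑ ^ 2) fun n hn => by simp [hn]]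
  refine tsum_congr fun n => ?_
  rw [annihilation, enorm_sqrt_mul_sq _ (by positivity)]
  congr 1
  simp only [Pi.add_apply, Pi.single_eq_same]
  rw [← ENNReal.ofReal_natCast]
  push_cast
  rfl

/-- The canonical commutation relation, as `‖a† f‖² = ‖a f‖² + ‖f‖²`. -/
theorem tsum_creation_sq (j : ι) (f : (ι → ℕ) → ℂ) :
    ∑' n, ‖creation j f n‖ₑ ^ 2 = ∑' n, ‖annihilation j f n‖ₑ ^ 2 + ∑' n, ‖f n‖ₑ ^ 2 := by
  rw [tsum_annihilation_sq, ← ENNReal.tsum_add, ← tsum_shift j fun n hn => by simp [creation, hn]]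
  refine tsum_congr fun n => ?_
  rw [creation, enorm_sqrt_mul_sq _ (by positivity), add_tsub_cancel_right, Pi.add_apply,
    Pi.single_eq_same, ENNReal.ofReal_natCast]
  push_cast
  ring

theorem inner_annihilation (j : ι) {ψ u w : Fock ι} (hu : (u : (ι → ℕ) → ℂ) = annihilation j ψ)
    (hw : (w : (ι → ℕ) → ℂ) = creation j ψ) : ⟪ψ, u⟫_ℂ = ⟪w, ψ⟫_ℂ := by
  have h1 := lp.hasSum_inner (𝕜 := ℂ) ψ u
  have h2 := lp.hasSum_inner (𝕜 := ℂ) w ψ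
  rw [← hasSum_shift j fun n hn => by simp [hw, creation, hn]] at h2
  refine h1.unique ?_
  have hterm : ∀ n : ι → ℕ, ⟪w (n + Pi.single j 1), ψ (n + Pi.single j 1)⟫_ℂ = ⟪ψ n, u n⟫_ℂ :=
    fun n => by
      rw [hu, hw, creation, annihilation, add_tsub_cancel_right]
      simp
      ring
  simp_rw [hterm] at h2
  exact h2

theorem enorm_sub_smul_sq {X : Type*} (g : X → ℂ) (h : ∑' x, ‖g x‖ₑ ^ 2 ≠ ⊤) (c : ℂ) (ψ : L2 X) :
    ∑' x, ‖g x - c * ψ x‖ₑ ^ 2 = ENNReal.ofReal (‖toL2 g h - c • ψ‖ ^ 2) := by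
  rw [ofReal_norm_sq, enorm_sq_eq]
  rfl

/-- The commutation relation for the centred operators, `‖(a† - c̄) ψ‖² = ‖(a - c) ψ‖² + ‖ψ‖²`,
including the case of infinite moments. -/
theorem tsum_creation_sub_sq (c : ℂ) (j : ι) (ψ : Fock ι) :
    ∑' n, ‖creation j ψ n - starRingEnd ℂ c * ψ n‖ₑ ^ 2 = modeDefect c j ψ + ‖ψ‖ₑ ^ 2 := by
  have h := tsum_creation_sq j (ψ : (ι → ℕ) → ℂ)
  by_cases hA : ∑' n, ‖annihilation j ψ n‖ₑ ^ 2 = ⊤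
  · have h1 : modeDefect c j (ψ : (ι → ℕ) → ℂ) = ⊤ := by
      by_contra hne
      exact (tsum_sub_mul_ne_top_iff _ _ _).1 hne hA
    rw [hA, top_add] at h
    rw [h1, top_add]
    by_contra hne
    exact (tsum_sub_mul_ne_top_iff _ _ _).1 hne h
  · have hB : ∑' n, ‖creation j ψ n‖ₑ ^ 2 ≠ ⊤ := by
      rw [h, ← enorm_sq_eq]
      finiteness
    rw [modeDefect, enorm_sub_smul_sq _ hA, enorm_sub_smul_sq _ hB, ← ofReal_norm_sq,
      ← ENNReal.ofReal_add (by positivity) (by positivity)]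
    congr 1
    have h1 : ‖toL2 _ hB‖ ^ 2 = ‖toL2 _ hA‖ ^ 2 + ‖ψ‖ ^ 2 := by
      have : ‖toL2 _ hB‖ₑ ^ 2 = ‖toL2 _ hA‖ₑ ^ 2 + ‖ψ‖ₑ ^ 2 := by
        simp_rw [enorm_sq_eq]
        exact h
      simp_rw [← ofReal_norm_sq] at this
      rw [← ENNReal.ofReal_add (by positivity) (by positivity)] at this
      exact (ENNReal.ofReal_eq_ofReal_iff (by positivity) (by positivity)).1 this
    have h2 : ⟪ψ, toL2 _ hA⟫_ℂ = ⟪toL2 _ hB, ψ⟫_ℂ := inner_annihilation j rfl rfl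
    rw [@norm_sub_sq ℂ, @norm_sub_sq ℂ, h1, inner_smul_right, inner_smul_right, ← h2,
      ← inner_conj_symm (toL2 _ hA) ψ, norm_smul, norm_smul, RCLike.norm_conj]
    have h3 : ∀ z : ℂ, (c * starRingEnd ℂ z).re = (starRingEnd ℂ c * z).re := fun z => by simp
    simp only [RCLike.re_to_complex, h3]
    ring

/-- The variance is the minimum of the centred second moments, attained at the mean. Only the real
part of the mean enters, so that the symmetry of the quadratures is not needed. -/
theorem quadratureDefect_eq_variance_add {ψ : Fock ι} (hψ : ‖ψ‖ = 1) (d : ℝ) (k : ι ⊕ ι) :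
    quadratureDefect d k ψ = variance ψ k + ENNReal.ofReal
      ((d - (∑' n, starRingEnd ℂ (ψ n) * quadrature k ψ n).re) ^ 2) := by
  rw [variance]
  simp_rw [ofReal_norm_sq]
  set m := (∑' n, starRingEnd ℂ (ψ n) * quadrature k ψ n).re with hm
  by_cases hV : ∑' n, ‖quadrature k ψ n‖ₑ ^ 2 = ⊤
  · rw [hV, ENNReal.top_sub ENNReal.ofReal_ne_top, top_add]
    by_contra hne
    exact (tsum_sub_mul_ne_top_iff _ _ _).1 hne hV
  · have h1 : m = (⟪ψ, toL2 _ hV⟫_ℂ).re := by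
      rw [hm, lp.inner_eq_tsum]
      congr 2
      funext n
      rw [RCLike.inner_apply, mul_comm]
      rfl
    have h2 : ∑' n, ‖quadrature k ψ n‖ₑ ^ 2 = ENNReal.ofReal (‖toL2 _ hV‖ ^ 2) := by
      rw [ofReal_norm_sq, enorm_sq_eq]
      rfl
    have h3 : m ^ 2 ≤ ‖toL2 _ hV‖ ^ 2 := by
      have h4 : |m| ≤ ‖toL2 _ hV‖ := by
        rw [h1]
        refine (Complex.abs_re_le_norm _).trans ((norm_inner_le_norm _ _).trans ?_)
        rw [hψ, one_mul]
      rw [← sq_abs]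
      exact pow_le_pow_left₀ (abs_nonneg _) h4 2
    rw [quadratureDefect, enorm_sub_smul_sq _ hV, h2, ← ENNReal.ofReal_sub _ (by positivity),
      ← ENNReal.ofReal_add (by linarith) (by positivity)]
    congr 1
    have h5 : (⟪toL2 _ hV, ψ⟫_ℂ).re = m := by
      rw [h1, ← inner_conj_symm, Complex.conj_re]
    rw [@norm_sub_sq ℂ, inner_smul_right, norm_smul, hψ, Complex.norm_real, Real.norm_eq_abs,
      mul_one, sq_abs]
    change _ - 2 * ((d : ℂ) * _).re + _ = _
    rw [Complex.re_ofReal_mul, h5]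
    ring

/-- Parallelogram law for `a - c` and `a† - c̄`, whose sum and difference are the centred
quadratures. -/
theorem quadratureDefect_inl_add_inr (c : ι → ℂ) (j : ι) (ψ : Fock ι) :
    quadratureDefect (quadratureCenter c (Sum.inl j)) (Sum.inl j) ψ +
      quadratureDefect (quadratureCenter c (Sum.inr j)) (Sum.inr j) ψ =
      2 * modeDefect (c j) j ψ + ‖ψ‖ₑ ^ 2 := by
  rw [two_mul, add_assoc, ← tsum_creation_sub_sq, modeDefect, quadratureDefect, quadratureDefect,
    ← ENNReal.tsum_add, ← ENNReal.tsum_add]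
  refine tsum_congr fun n => ?_
  set p := annihilation j ψ n - c j * ψ n with hp
  set q := creation j ψ n - starRingEnd ℂ (c j) * ψ n with hq
  have h2 : ((√2 : ℝ) : ℂ) ^ 2 = 2 := by
    norm_cast
    simp
  have h20 : ((√2 : ℝ) : ℂ) ≠ 0 := by
    norm_cast
    simp
  have hx : quadrature (Sum.inl j) ψ n - (quadratureCenter c (Sum.inl j) : ℂ) * ψ n =
      (p + q) / (√2 : ℂ) := by
    have hc : c j + starRingEnd ℂ (c j) = 2 * ((c j).re : ℂ) := by
      rw [Complex.add_conj]; push_cast; ring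
    rw [hp, hq, quadrature, quadratureCenter]
    push_cast
    field_simp
    linear_combination (((c j).re : ℂ) * ψ n) * (-h2) + ψ n * hc
  have hpq : quadrature (Sum.inr j) ψ n - (quadratureCenter c (Sum.inr j) : ℂ) * ψ n =
      (p - q) / ((√2 : ℂ) * Complex.I) := by
    have hc : c j - starRingEnd ℂ (c j) = 2 * ((c j).im : ℂ) * Complex.I := by
      rw [Complex.sub_conj]; push_cast; ring
    rw [hp, hq, quadrature, quadratureCenter]
    push_cast
    field_simp
    linear_combination (((c j).im : ℂ) * Complex.I * ψ n) * (-h2) + ψ n * hc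
  rw [hx, hpq]
  simp_rw [← ofReal_norm_sq]
  rw [← ENNReal.ofReal_add (by positivity) (by positivity),
    ← ENNReal.ofReal_add (by positivity) (by positivity)]
  congr 1
  have h := parallelogram_law_with_norm ℂ p q
  simp only [norm_div, norm_mul, Complex.norm_I, mul_one, Complex.norm_real, Real.norm_eq_abs,
    div_pow, sq_abs]
  rw [Real.sq_sqrt (by norm_num)]
  linarith

variable [Fintype ι]

theorem sum_quadratureDefect (c : ι → ℂ) (ψ : Fock ι) :
    ∑ k, quadratureDefect (quadratureCenter c k) k ψ =
      2 * defect c ψ + Fintype.card ι * ‖ψ‖ₑ ^ 2 := by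
  rw [Fintype.sum_sum_type, ← Finset.sum_add_distrib]
  simp_rw [quadratureDefect_inl_add_inr]
  rw [Finset.sum_add_distrib, ← Finset.mul_sum, defect]
  simp

theorem sum_variance_le {ψ : Fock ι} (hψ : ‖ψ‖ = 1) (c : ι → ℂ) :
    ∑ k, variance ψ k ≤ 2 * defect c ψ + Fintype.card ι := by
  have h := sum_quadratureDefect c ψ
  rw [← ofReal_norm_sq, hψ] at h
  simp only [one_pow, ENNReal.ofReal_one, mul_one] at h
  rw [← h]
  refine Finset.sum_le_sum fun k _ => ?_
  rw [quadratureDefect_eq_variance_add hψ]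
  exact le_self_add

theorem exists_sum_variance_eq {ψ : Fock ι} (hψ : ‖ψ‖ = 1) :
    ∃ c, ∑ k, variance ψ k = 2 * defect c ψ + Fintype.card ι := by
  obtain ⟨c, hc⟩ := exists_quadratureCenter_eq (ι := ι)
    fun k => (∑' n, starRingEnd ℂ (ψ n) * quadrature k ψ n).re
  refine ⟨c, ?_⟩
  have h := sum_quadratureDefect c ψ
  rw [← ofReal_norm_sq, hψ] at h
  simp only [one_pow, ENNReal.ofReal_one, mul_one] at h
  rw [← h]
  refine Finset.sum_congr rfl fun k _ => ?_
  rw [quadratureDefect_eq_variance_add hψ, hc]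
  simp

/-! ### Linear optical unitaries -/

theorem sum_norm_orthogonal_sq {H : Type*} [NormedAddCommGroup H] [InnerProductSpace ℂ H]
    {κ : Type*} [Fintype κ] [DecidableEq κ] {O : Matrix κ κ ℝ}
    (hO : O ∈ Matrix.orthogonalGroup κ ℝ) (r : κ → H) :
    ∑ k, ‖∑ l, (O k l : ℂ) • r l‖ ^ 2 = ∑ l, ‖r l‖ ^ 2 := by
  have hO' : ∀ l m, ∑ k, O k l * O k m = if l = m then 1 else 0 := fun l m => by
    have := congrFun (congrFun ((Matrix.mem_orthogonalGroup_iff' κ ℝ).1 hO) l) m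
    simpa [Matrix.mul_apply, Matrix.one_apply, Matrix.star_eq_conjTranspose] using this
  have key : ∑ k, ⟪∑ l, (O k l : ℂ) • r l, ∑ l, (O k l : ℂ) • r l⟫_ℂ = ∑ l, ⟪r l, r l⟫_ℂ := by
    simp_rw [sum_inner, inner_sum, inner_smul_left, inner_smul_right, Complex.conj_ofReal]
    rw [Finset.sum_comm]
    refine Finset.sum_congr rfl fun l _ => ?_
    rw [Finset.sum_comm]
    have : ∀ m, ∑ k, (O k l : ℂ) * ((O k m : ℂ) * ⟪r l, r m⟫_ℂ) =
        if l = m then ⟪r l, r m⟫_ℂ else 0 := fun m => by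
      simp_rw [← mul_assoc, ← Finset.sum_mul]
      have h := congrArg (fun x : ℝ => (x : ℂ)) (hO' l m)
      push_cast at h
      rw [h]
      split_ifs <;> simp
    simp_rw [this]
    simp
  simp_rw [inner_self_eq_norm_sq_to_K] at key
  exact_mod_cast key

theorem IsLinearOpticalUnitary.norm_map {U : FockOp ι} (hU : IsLinearOpticalUnitary U)
    (ψ : Fock ι) : ‖U ψ‖ = ‖ψ‖ := by
  have h : star U * U = 1 := Unitary.star_mul_self_of_mem hU.1
  have h1 : ⟪U ψ, U ψ⟫_ℂ = ⟪ψ, ψ⟫_ℂ := by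
    rw [← ContinuousLinearMap.adjoint_inner_right]
    exact congrArg (fun S : FockOp ι => ⟪ψ, S ψ⟫_ℂ) h
  rw [inner_self_eq_norm_sq_to_K, inner_self_eq_norm_sq_to_K] at h1
  have h2 : ‖U ψ‖ ^ 2 = ‖ψ‖ ^ 2 := by exact_mod_cast h1
  exact (pow_left_inj₀ (norm_nonneg _) (norm_nonneg _) two_ne_zero).1 h2

/-- A linear optical unitary moves the centres but preserves the total centred second moment. -/
theorem IsLinearOpticalUnitary.exists_defect_eq {U : FockOp ι} (hU : IsLinearOpticalUnitary U)
    {c : ι → ℂ} {ψ : Fock ι} (h : defect c ψ ≠ ⊤) : ∃ c', defect c' (U ψ) = defect c ψ := by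
  have hnorm := hU.norm_map ψ
  have hiso := hU.norm_map
  obtain ⟨-, O, hO, d, hUd⟩ := hU
  have hsum := sum_quadratureDefect c ψ
  have hfin : ∀ k, quadratureDefect (quadratureCenter c k) k ψ ≠ ⊤ := by
    have : ∑ k, quadratureDefect (quadratureCenter c k) k ψ ≠ ⊤ := by
      rw [hsum]
      finiteness
    exact fun k => ENNReal.sum_ne_top.1 this k (Finset.mem_univ k)
  have hR : ∀ k, ∑' n, ‖quadrature k ψ n‖ₑ ^ 2 ≠ ⊤ := fun k =>
    (tsum_sub_mul_ne_top_iff _ _ _).1 (hfin k)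
  set R : ι ⊕ ι → Fock ι := fun k => toL2 _ (hR k)
  set x := quadratureCenter c
  -- the new quadrature centres are the images of the old ones under `x ↦ O x + d`
  obtain ⟨c', hc'⟩ := exists_quadratureCenter_eq (ι := ι) fun k => ∑ l, O k l * x l + d k
  have h1 : ∀ k, quadratureDefect (quadratureCenter c' k) k (U ψ) =
      ENNReal.ofReal (‖∑ l, (O k l : ℂ) • (R l - (x l : ℂ) • ψ)‖ ^ 2) := fun k => by
    have e1 : U ((∑ l, (O k l : ℂ) • R l) + (d k : ℂ) • ψ) -
        ((∑ l, O k l * x l + d k : ℝ) : ℂ) • U ψ =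
        U (∑ l, (O k l : ℂ) • (R l - (x l : ℂ) • ψ)) := by
      rw [← map_smul, ← map_sub]
      congr 1
      simp only [smul_sub, Finset.sum_sub_distrib, smul_smul]
      push_cast
      rw [← Finset.sum_smul, add_smul]
      abel
    rw [quadratureDefect, hUd ψ R (fun l => rfl) k, hc', ← hiso, ← e1, ofReal_norm_sq, enorm_sq_eq]
    rfl
  have h2 : ∀ l, quadratureDefect (x l) l ψ = ENNReal.ofReal (‖R l - (x l : ℂ) • ψ‖ ^ 2) :=
    fun l => enorm_sub_smul_sq _ (hR l) _ _
  have hsum' := sum_quadratureDefect c' (U ψ)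
  have h3 : ∑ k, quadratureDefect (quadratureCenter c' k) k (U ψ) =
      ∑ k, quadratureDefect (x k) k ψ := by
    simp_rw [h1, h2]
    rw [← ENNReal.ofReal_sum_of_nonneg fun _ _ => by positivity,
      ← ENNReal.ofReal_sum_of_nonneg fun _ _ => by positivity, sum_norm_orthogonal_sq hO]
  rw [h3, hsum, ← ofReal_norm_sq, ← ofReal_norm_sq, hnorm] at hsum'
  have h4 := (ENNReal.add_left_inj (by finiteness)).1 hsum'
  exact ⟨c', ((ENNReal.mul_right_inj two_ne_zero ENNReal.ofNat_ne_top).1 h4).symm⟩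

end Defect

/-! ### Subsystems of modes -/

theorem tsum_enorm_inner_sq_le {H β : Type*} [NormedAddCommGroup H] [InnerProductSpace ℂ H]
    {w : β → H} (hw : Orthonormal ℂ w) (g : H) : ∑' b, ‖⟪w b, g⟫_ℂ‖ₑ ^ 2 ≤ ‖g‖ₑ ^ 2 := by
  rw [← ofReal_tsum_norm_sq (E := ℂ) (f := fun b => ⟪w b, g⟫_ℂ)
    (Orthonormal.inner_products_summable g hw), ← ofReal_norm_sq]
  exact ENNReal.ofReal_le_ofReal (Orthonormal.tsum_inner_products_le g hw)

section Subsystem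

variable {ι κ Y : Type*} [DecidableEq ι] [DecidableEq κ]

/-- The bijection `e`, splitting the number states of the modes `ι`, has as its first component the
number states of the modes `i '' κ`. -/
structure IsModeSplitting (e : (ι → ℕ) ≃ (κ → ℕ) × Y) (i : κ → ι) : Prop where
  apply_eq : ∀ n j, n (i j) = (e n).1 j
  add_single : ∀ n j, e (n + Pi.single (i j) 1) = ((e n).1 + Pi.single j 1, (e n).2)

variable {e : (ι → ℕ) ≃ (κ → ℕ) × Y} {i : κ → ι}

theorem IsModeSplitting.annihilation_symm (h : IsModeSplitting e i) (j : κ) (f : (ι → ℕ) → ℂ)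
    (x : κ → ℕ) (y : Y) : annihilation (i j) f (e.symm (x, y)) =
      (√((x j : ℝ) + 1) : ℂ) * f (e.symm (x + Pi.single j 1, y)) := by
  have h1 : e.symm (x, y) + Pi.single (i j) 1 = e.symm (x + Pi.single j 1, y) := by
    rw [Equiv.eq_symm_apply, h.add_single]
    simp
  rw [annihilation, h.apply_eq (e.symm (x, y)) j, h1]
  simp

theorem IsModeSplitting.modeDefect_eq (h : IsModeSplitting e i) (c : ℂ) (j : κ)
    (f : (ι → ℕ) → ℂ) : modeDefect c (i j) f = ∑' (x : κ → ℕ) (y : Y),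
      ‖(√((x j : ℝ) + 1) : ℂ) * f (e.symm (x + Pi.single j 1, y)) -
        c * f (e.symm (x, y))‖ₑ ^ 2 := by
  rw [← ENNReal.tsum_prod, modeDefect, ← e.symm.tsum_eq]
  exact tsum_congr fun q => by rw [← h.annihilation_symm]

theorem IsModeSplitting.modeDefect_tensorVec (h : IsModeSplitting e i) (c : ℂ) (j : κ)
    (ψ : Fock κ) (φ : L2 Y) :
    modeDefect c (i j) (tensorVec e ψ φ) = modeDefect c j ψ * ‖φ‖ₑ ^ 2 := by
  rw [h.modeDefect_eq, modeDefect, ← ENNReal.tsum_mul_right]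
  refine tsum_congr fun x => ?_
  rw [enorm_sq_eq, ← ENNReal.tsum_mul_left]
  refine tsum_congr fun y => ?_
  rw [← mul_pow, ← enorm_mul]
  simp only [tensorVec_apply, Equiv.apply_symm_apply, annihilation]
  congr 2
  ring

/-- Bessel's inequality for the outcomes of a measurement on the complementary subsystem. -/
theorem IsModeSplitting.tsum_modeDefect_bra_le (h : IsModeSplitting e i) (c : ℂ) (j : κ)
    {β : Type*} {w : β → L2 Y} (hw : Orthonormal ℂ w) (Ψ : Fock ι) :
    ∑' b, modeDefect c j (bra e (w b) Ψ) ≤ modeDefect c (i j) Ψ := by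
  rw [h.modeDefect_eq]
  simp only [modeDefect]
  rw [ENNReal.tsum_comm]
  refine ENNReal.tsum_le_tsum fun x => ?_
  set g : L2 Y := (√((x j : ℝ) + 1) : ℂ) •
      slice (e.trans (Equiv.prodComm _ Y)) (x + Pi.single j 1) Ψ -
    c • slice (e.trans (Equiv.prodComm _ Y)) x Ψ with hg
  have h1 : ∀ b, annihilation j (bra e (w b) Ψ) x - c * bra e (w b) Ψ x = ⟪w b, g⟫_ℂ := fun b => by
    rw [hg, inner_sub_right, inner_smul_right, inner_smul_right]
    rfl
  have h2 : ∑' y, ‖(√((x j : ℝ) + 1) : ℂ) * Ψ (e.symm (x + Pi.single j 1, y)) -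
      c * Ψ (e.symm (x, y))‖ₑ ^ 2 = ‖g‖ₑ ^ 2 := by
    rw [enorm_sq_eq]
    rfl
  simp_rw [h1]
  rw [h2]
  exact tsum_enorm_inner_sq_le hw g

end Subsystem

theorem isModeSplitting_modeSplit (A E : Type*) [DecidableEq A] [DecidableEq E] :
    IsModeSplitting (modeSplit A E) Sum.inl where
  apply_eq _ _ := rfl
  add_single n j := by
    refine Prod.ext (funext fun k => ?_) (funext fun k => ?_)
    · change n (Sum.inl k) + (Pi.single (Sum.inl j) 1 : A ⊕ E → ℕ) (Sum.inl k) =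
        n (Sum.inl k) + (Pi.single j 1 : A → ℕ) k
      simp [Pi.single_apply]
    · change n (Sum.inr k) + (Pi.single (Sum.inl j) 1 : A ⊕ E → ℕ) (Sum.inr k) = n (Sum.inr k)
      simp

theorem isModeSplitting_modeSplit_prodComm (A E : Type*) [DecidableEq A] [DecidableEq E] :
    IsModeSplitting ((modeSplit A E).trans (Equiv.prodComm _ _)) Sum.inr where
  apply_eq _ _ := rfl
  add_single n j := by
    refine Prod.ext (funext fun k => ?_) (funext fun k => ?_)
    · change n (Sum.inr k) + (Pi.single (Sum.inr j) 1 : A ⊕ E → ℕ) (Sum.inr k) =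
        n (Sum.inr k) + (Pi.single j 1 : E → ℕ) k
      simp [Pi.single_apply]
    · change n (Sum.inl k) + (Pi.single (Sum.inr j) 1 : A ⊕ E → ℕ) (Sum.inl k) = n (Sum.inl k)
      simp

theorem isModeSplitting_modeSplitAssoc (A E' E : Type*) [DecidableEq A] [DecidableEq E']
    [DecidableEq E] : IsModeSplitting (modeSplitAssoc A E' E)
      fun k : A ⊕ E' => Equiv.sumAssoc A E' E (Sum.inl k) where
  apply_eq _ _ := rfl
  add_single n j := by
    refine Prod.ext (funext fun k => ?_) (funext fun k => ?_)
    · change n (Equiv.sumAssoc A E' E (Sum.inl k)) +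
          (Pi.single (Equiv.sumAssoc A E' E (Sum.inl j)) 1 : A ⊕ (E' ⊕ E) → ℕ)
            (Equiv.sumAssoc A E' E (Sum.inl k)) =
        n (Equiv.sumAssoc A E' E (Sum.inl k)) + (Pi.single j 1 : A ⊕ E' → ℕ) k
      simp [Pi.single_apply]
    · change n (Equiv.sumAssoc A E' E (Sum.inr k)) +
          (Pi.single (Equiv.sumAssoc A E' E (Sum.inl j)) 1 : A ⊕ (E' ⊕ E) → ℕ)
            (Equiv.sumAssoc A E' E (Sum.inr k)) = n (Equiv.sumAssoc A E' E (Sum.inr k))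
      rw [Pi.single_eq_of_ne ((Equiv.sumAssoc A E' E).injective.ne Sum.inr_ne_inl), add_zero]

theorem defect_tensorVec {A E : Type*} [Fintype A] [Fintype E] [DecidableEq A] [DecidableEq E]
    (c : A ⊕ E → ℂ) (ψ : Fock A) (φ : Fock E) :
    defect c (tensorVec (modeSplit A E) ψ φ) =
      defect (fun j => c (Sum.inl j)) ψ * ‖φ‖ₑ ^ 2 +
        ‖ψ‖ₑ ^ 2 * defect (fun j => c (Sum.inr j)) φ := by
  have h : tensorVec (modeSplit A E) ψ φ =
      tensorVec ((modeSplit A E).trans (Equiv.prodComm _ _)) φ ψ := by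
    ext z
    exact mul_comm _ _
  rw [defect, Fintype.sum_sum_type, defect, defect, Finset.sum_mul, Finset.mul_sum]
  congr 1
  · exact Finset.sum_congr rfl fun j _ =>
      (isModeSplitting_modeSplit A E).modeDefect_tensorVec _ j ψ φ
  · refine Finset.sum_congr rfl fun j _ => ?_
    rw [h, (isModeSplitting_modeSplit_prodComm A E).modeDefect_tensorVec, mul_comm]

/-! ### The convex roof in terms of centred second moments -/

theorem tsum_mul_two_mul_defect_add {ι : Type*} [Fintype ι] [Nonempty ι]
    {p : ℕ → ℝ≥0} (hp : ∑' i, (p i : ℝ≥0∞) = 1)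
    (D : ℕ → ℝ≥0∞) : ∑' i, (p i : ℝ≥0∞) * ((2 * D i + Fintype.card ι) / Fintype.card ι) =
      2 / Fintype.card ι * ∑' i, p i * D i + 1 := by
  have h0 : (Fintype.card ι : ℝ≥0∞) ≠ 0 := by simp
  rw [← hp, ← ENNReal.tsum_mul_left, ← ENNReal.tsum_add]
  refine tsum_congr fun i => ?_
  rw [ENNReal.add_div, ENNReal.div_self h0 (by simp), mul_add, mul_one, ENNReal.div_eq_inv_mul,
    ENNReal.div_eq_inv_mul]
  ring

section Roof

variable {ι : Type*} [Fintype ι] [DecidableEq ι]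

theorem defect_smul (c : ι → ℂ) (r : ℂ) (ψ : Fock ι) :
    defect c (r • ψ : Fock ι) = ‖r‖ₑ ^ 2 * defect c ψ := by
  simp only [defect, modeDefect, Finset.mul_sum, ← ENNReal.tsum_mul_left]
  refine Finset.sum_congr rfl fun j _ => tsum_congr fun n => ?_
  rw [← mul_pow, ← enorm_mul]
  congr 2
  change (√((n j : ℝ) + 1) : ℂ) * (r * _) - c j * (r * _) = r * ((√((n j : ℝ) + 1) : ℂ) * _ - _)
  ring

theorem defect_zero (c : ι → ℂ) : defect c (0 : Fock ι) = 0 := by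
  simpa using defect_smul c 0 (0 : Fock ι)

theorem IsPureDecomposition.tsum_coe {X : Type*} {p : ℕ → ℝ≥0} {ψ : ℕ → L2 X} {ρ : Op X}
    (h : IsPureDecomposition p ψ ρ) : ∑' i, (p i : ℝ≥0∞) = 1 := by
  rw [← ENNReal.coe_tsum h.1.summable, h.1.tsum_eq, ENNReal.coe_one]

theorem IsPureDecomposition.isEnsemble {X : Type*} {p : ℕ → ℝ≥0} {ψ : ℕ → L2 X} {ρ : Op X}
    (h : IsPureDecomposition p ψ ρ) : IsEnsemble (fun i => ((√(p i) : ℝ) : ℂ) • ψ i) ρ where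
  summable := by
    simp_rw [norm_smul, h.2.1, Complex.norm_real, Real.norm_eq_abs, mul_one, sq_abs,
      Real.sq_sqrt (NNReal.coe_nonneg _)]
    exact NNReal.summable_coe.2 h.1.summable
  hasSum := by
    simp_rw [ketbra_smul, Real.sq_sqrt (NNReal.coe_nonneg _)]
    exact h.2.2

variable [Nonempty ι]

/-- `V̄ ≥ 1`: the convex roof is at least the vacuum value. -/
theorem one_le_varianceRoof (ρ : FockOp ι) : 1 ≤ varianceRoof ρ := by
  refine le_iInf fun p => le_iInf fun ψ => le_iInf fun h => ?_
  choose c hc using fun i => exists_sum_variance_eq (h.2.1 i)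
  simp_rw [meanVariance, hc]
  rw [tsum_mul_two_mul_defect_add h.tsum_coe]
  exact le_add_self

theorem Q_le_of_isPureDecomposition {p : ℕ → ℝ≥0} {ψ : ℕ → Fock ι} {ρ : FockOp ι}
    (h : IsPureDecomposition p ψ ρ) (c : ℕ → ι → ℂ) :
    Q ρ ≤ 2 / Fintype.card ι * ∑' i, (p i : ℝ≥0∞) * defect (c i) (ψ i) := by
  rw [Q, tsub_le_iff_right, ← tsum_mul_two_mul_defect_add h.tsum_coe]
  refine (iInf₂_le_of_le p ψ (iInf_le _ h)).trans (ENNReal.tsum_le_tsum fun i => ?_)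
  exact mul_le_mul_right (ENNReal.div_le_div_right (sum_variance_le (h.2.1 i) (c i)) _) _

theorem exists_isPureDecomposition_of_Q_lt {ρ : FockOp ι} {r : ℝ≥0∞} (h : Q ρ < r) :
    ∃ (p : ℕ → ℝ≥0) (ψ : ℕ → Fock ι) (c : ℕ → ι → ℂ), IsPureDecomposition p ψ ρ ∧
      2 / Fintype.card ι * ∑' i, (p i : ℝ≥0∞) * defect (c i) (ψ i) < r := by
  have h1 : varianceRoof ρ < r + 1 := by
    by_contra! hle
    exact absurd (ENNReal.le_sub_of_add_le_right ENNReal.one_ne_top hle) (not_le.2 h)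
  simp only [varianceRoof, iInf_lt_iff] at h1
  obtain ⟨p, ψ, hd, hlt⟩ := h1
  choose c hc using fun i => exists_sum_variance_eq (hd.2.1 i)
  refine ⟨p, ψ, c, hd, ?_⟩
  simp_rw [meanVariance, hc] at hlt
  rw [tsum_mul_two_mul_defect_add hd.tsum_coe] at hlt
  exact lt_of_add_lt_add_right hlt

theorem enorm_sqrt_coe_sq (p : ℝ≥0) : ‖((√p : ℝ) : ℂ)‖ₑ ^ 2 = p := by
  rw [← ofReal_norm_sq, Complex.norm_real, Real.norm_eq_abs, sq_abs,
    Real.sq_sqrt (NNReal.coe_nonneg _), ENNReal.ofReal_coe_nnreal]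

theorem exists_isEnsemble_of_Q_lt {ρ : FockOp ι} {r : ℝ≥0∞} (h : Q ρ < r) :
    ∃ (χ : ℕ → Fock ι) (c : ℕ → ι → ℂ), IsEnsemble χ ρ ∧
      2 / Fintype.card ι * ∑' i, defect (c i) (χ i) < r := by
  obtain ⟨p, ψ, c, hd, hlt⟩ := exists_isPureDecomposition_of_Q_lt h
  refine ⟨_, c, hd.isEnsemble, ?_⟩
  simpa only [defect_smul, enorm_sqrt_coe_sq] using hlt

theorem IsEnsemble.mul_Q_le_nat {χ : ℕ → Fock ι} {T : FockOp ι} (h : IsEnsemble χ T)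
    (c : ℕ → ι → ℂ) :
    ENNReal.ofReal (∑' b, ‖χ b‖ ^ 2) * Q (((∑' b, ‖χ b‖ ^ 2 : ℝ) : ℂ)⁻¹ • T) ≤
      2 / Fintype.card ι * ∑' b, defect (c b) (χ b) := by
  classical
  set P : ℝ := ∑' b, ‖χ b‖ ^ 2 with hP
  have hP0 : 0 ≤ P := tsum_nonneg fun b => by positivity
  rcases hP0.eq_or_lt with hP1 | hP1
  · simp [← hP1]
  set p : ℕ → ℝ≥0 := fun b => (‖χ b‖ ^ 2 / P).toNNReal
  have hp : ∀ b, (p b : ℝ) = ‖χ b‖ ^ 2 / P := fun b => Real.coe_toNNReal _ (by positivity)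
  -- zero vectors get weight zero, and are replaced by the vacuum to have unit vectors throughout
  set ψ : ℕ → Fock ι := fun b =>
    if χ b = 0 then basisVec 0 else ((‖χ b‖⁻¹ : ℝ) : ℂ) • χ b with hψ
  have hd : IsPureDecomposition p ψ (((P : ℝ) : ℂ)⁻¹ • T) := by
    refine ⟨?_, fun b => ?_, ?_⟩
    · rw [← NNReal.hasSum_coe]
      simp_rw [hp]
      have := h.summable.hasSum.div_const P
      rwa [← hP, div_self hP1.ne'] at this
    · by_cases hb : χ b = 0
      · simp [hψ, hb, norm_basisVec]
      · have : ‖χ b‖ ≠ 0 := norm_ne_zero_iff.2 hb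
        simp [hψ, hb, norm_smul, this]
    · have h1 := h.hasSum.const_smul ((P : ℂ)⁻¹)
      have h2 : ∀ b, ((p b : ℝ) : ℂ) • ketbra (ψ b) = (P : ℂ)⁻¹ • ketbra (χ b) := fun b => by
        by_cases hb : χ b = 0
        · have : ketbra (χ b) = 0 := by rw [← norm_eq_zero, norm_ketbra, hb]; simp
          rw [this]
          simp [hp, hb]
        · have hb' : ‖χ b‖ ≠ 0 := norm_ne_zero_iff.2 hb
          simp only [hψ, hb, if_false, ketbra_smul, smul_smul]
          congr 1
          rw [hp]
          norm_cast
          field_simp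
      simp_rw [h2]
      exact h1
  have hdef : ∀ b, ENNReal.ofReal P * ((p b : ℝ≥0∞) * defect (c b) (ψ b)) = defect (c b) (χ b) :=
    fun b => by
      have hpP : ENNReal.ofReal P * (p b : ℝ≥0∞) = ENNReal.ofReal (‖χ b‖ ^ 2) := by
        rw [← ENNReal.ofReal_coe_nnreal, ← ENNReal.ofReal_mul hP0]
        congr 1
        rw [hp]
        field_simp
      rw [← mul_assoc, hpP]
      by_cases hb : χ b = 0
      · rw [hb, defect_zero]
        simp
      · have hb' : ‖χ b‖ ≠ 0 := norm_ne_zero_iff.2 hb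
        simp only [hψ, hb, if_false, defect_smul]
        rw [← mul_assoc, ← ofReal_norm_sq, ← ENNReal.ofReal_mul (by positivity), Complex.norm_real,
          norm_inv, norm_norm, ← mul_pow, mul_inv_cancel₀ hb']
        simp
  calc _ ≤ ENNReal.ofReal P *
        (2 / Fintype.card ι * ∑' b, (p b : ℝ≥0∞) * defect (c b) (ψ b)) :=
        mul_le_mul_right (Q_le_of_isPureDecomposition hd c) _
    _ = 2 / Fintype.card ι * ∑' b, defect (c b) (χ b) := by
        rw [mul_left_comm, ← ENNReal.tsum_mul_left]
        simp_rw [hdef]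

theorem comp_extend_zero {α β M N : Type*} [Zero M] [Zero N] {f : α → β}
    (hf : Function.Injective f) (g : α → M) {F : M → N} (hF : F 0 = 0) :
    (fun n => F (Function.extend f g 0 n)) = Function.extend f (fun b => F (g b)) 0 := by
  funext n
  by_cases hn : ∃ b, f b = n
  · obtain ⟨b, rfl⟩ := hn
    simp only [hf.extend_apply]
  · simp only [Function.extend_apply' _ _ _ hn, Pi.zero_apply, hF]

/-- Any unnormalised countable ensemble of `T` bounds `Q` of the normalised operator. -/
theorem IsEnsemble.mul_Q_le {β : Type*} [Countable β] {χ : β → Fock ι} {T : FockOp ι}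
    (h : IsEnsemble χ T) (c : β → ι → ℂ) :
    ENNReal.ofReal (∑' b, ‖χ b‖ ^ 2) * Q (((∑' b, ‖χ b‖ ^ 2 : ℝ) : ℂ)⁻¹ • T) ≤
      2 / Fintype.card ι * ∑' b, defect (c b) (χ b) := by
  obtain ⟨f, hf⟩ := exists_injective_nat β
  set χ' : ℕ → Fock ι := Function.extend f χ 0
  have hsq := comp_extend_zero hf χ (F := fun v => ‖v‖ ^ 2) (by simp)
  have hkb := comp_extend_zero hf χ (F := ketbra) (by rw [← norm_eq_zero, norm_ketbra]; simp)
  have h' : IsEnsemble χ' T := by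
    refine ⟨?_, ?_⟩
    · rw [hsq]
      exact (hasSum_extend_zero hf).2 h.summable.hasSum |>.summable
    · rw [hkb]
      exact (hasSum_extend_zero hf).2 h.hasSum
  have key := h'.mul_Q_le_nat (Function.extend f c 0)
  have hdef : (fun n => defect (Function.extend f c 0 n) (χ' n)) =
      Function.extend f (fun b => defect (c b) (χ b)) 0 := by
    funext n
    by_cases hn : ∃ b, f b = n
    · obtain ⟨b, rfl⟩ := hn
      simp only [χ', hf.extend_apply]
    · simp only [χ', Function.extend_apply' _ _ _ hn, Pi.zero_apply, defect_zero]
  rwa [hsq, hdef, tsum_extend_zero hf, tsum_extend_zero hf] at key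

theorem IsEnsemble.Q_le {β : Type*} [Countable β] {χ : β → Fock ι} {T : FockOp ι}
    (h : IsEnsemble χ T) (hn : ∑' b, ‖χ b‖ₑ ^ 2 = 1) (c : β → ι → ℂ) :
    Q T ≤ 2 / Fintype.card ι * ∑' b, defect (c b) (χ b) := by
  have hP : ∑' b, ‖χ b‖ ^ 2 = 1 := by
    rw [← ofReal_tsum_norm_sq h.summable] at hn
    simpa using hn
  have key := h.mul_Q_le c
  rw [hP] at key
  simpa using key

end Roof

/-! ### Coherent states -/

/-- Distributivity for a finite product of series. -/
theorem hasSum_pi_prod {ι 𝕜 : Type*} [Fintype ι] [RCLike 𝕜] {f : ι → ℕ → 𝕜} {a : ι → 𝕜}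
    (hf : ∀ j, HasSum (f j) (a j)) (hs : Summable fun n : ι → ℕ => ∏ j, f j (n j)) :
    HasSum (fun n : ι → ℕ => ∏ j, f j (n j)) (∏ j, a j) := by
  classical
  have h1 : Tendsto (fun N => Fintype.piFinset fun _ : ι => Finset.range N) atTop atTop := by
    refine tendsto_atTop_finset_of_monotone
      (fun N M h => Fintype.piFinset_subset _ _ fun _ => Finset.range_mono h) fun n => ?_
    refine ⟨∑ j, n j + 1, Fintype.mem_piFinset.2 fun j => Finset.mem_range.2 ?_⟩
    exact Nat.lt_succ_of_le (Finset.single_le_sum (fun _ _ => Nat.zero_le _) (Finset.mem_univ j))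
  have h2 := hs.hasSum.comp h1
  have h3 : Tendsto (fun N => ∏ j, ∑ m ∈ Finset.range N, f j m) atTop (𝓝 (∏ j, a j)) :=
    tendsto_finsetProd _ fun j _ => (hf j).tendsto_sum_nat
  have h4 : ((fun s : Finset (ι → ℕ) => ∑ n ∈ s, ∏ j, f j (n j)) ∘
      fun N => Fintype.piFinset fun _ : ι => Finset.range N) =
      fun N => ∏ j, ∑ m ∈ Finset.range N, f j m := by
    funext N
    rw [Finset.prod_univ_sum]
    rfl
  rw [h4] at h2
  rw [← tendsto_nhds_unique h2 h3]
  exact hs.hasSum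

section Coherent

variable {ι : Type*} [Fintype ι]

theorem coherent_apply (α : ι → ℂ) (n : ι → ℕ) :
    coherent α n = ∏ j, (Real.exp (-‖α j‖ ^ 2 / 2) : ℂ) * α j ^ n j /
      (√((n j).factorial : ℝ) : ℂ) := rfl

theorem inner_coherent (β α : ι → ℂ) : ⟪coherent β, coherent α⟫_ℂ =
    ∏ j, ((Real.exp (-‖β j‖ ^ 2 / 2) : ℂ) * (Real.exp (-‖α j‖ ^ 2 / 2) : ℂ) *
      Complex.exp (starRingEnd ℂ (β j) * α j)) := by
  have h1 := lp.hasSum_inner (𝕜 := ℂ) (coherent β) (coherent α)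
  set f : ι → ℕ → ℂ := fun j m => (Real.exp (-‖β j‖ ^ 2 / 2) : ℂ) *
    (Real.exp (-‖α j‖ ^ 2 / 2) : ℂ) * ((starRingEnd ℂ (β j) * α j) ^ m / (m.factorial : ℂ))
  have h2 : ∀ n : ι → ℕ, ⟪coherent β n, coherent α n⟫_ℂ = ∏ j, f j (n j) := fun n => by
    rw [coherent_apply, coherent_apply, RCLike.inner_apply, map_prod, ← Finset.prod_mul_distrib]
    refine Finset.prod_congr rfl fun j _ => ?_
    have h3 : (√((n j).factorial : ℝ) : ℂ) * (√((n j).factorial : ℝ) : ℂ) = (n j).factorial := by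
      rw [← Complex.ofReal_mul, Real.mul_self_sqrt (by positivity), Complex.ofReal_natCast]
    have h4 : ((n j).factorial : ℂ) ≠ 0 := by exact_mod_cast (n j).factorial_ne_zero
    have h5 : (√((n j).factorial : ℝ) : ℂ) ≠ 0 := fun h => by simp [h] at h3; exact h4 h3.symm
    simp only [f, map_div₀, map_mul, map_pow, Complex.conj_ofReal]
    rw [← h3, mul_pow]
    field_simp
  simp_rw [h2] at h1
  refine h1.unique (hasSum_pi_prod (fun j => ?_) h1.summable)
  have := NormedSpace.expSeries_div_hasSum_exp (starRingEnd ℂ (β j) * α j)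
  rw [← Complex.exp_eq_exp_ℂ] at this
  exact this.mul_left _

theorem norm_coherent (α : ι → ℂ) : ‖coherent α‖ = 1 := by
  have h : ⟪coherent α, coherent α⟫_ℂ = 1 := by
    rw [inner_coherent]
    refine Finset.prod_eq_one fun j _ => ?_
    rw [← Complex.normSq_eq_conj_mul_self, Complex.normSq_eq_norm_sq, ← Complex.ofReal_exp,
      ← Complex.ofReal_mul, ← Complex.ofReal_mul, ← Real.exp_add, ← Real.exp_add]
    ring_nf
    simp
  rw [inner_self_eq_norm_sq_to_K] at h
  have h2 : ‖coherent α‖ ^ 2 = 1 := Complex.ofReal_injective (by simpa using h)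
  exact (pow_eq_one_iff_of_nonneg (norm_nonneg _) two_ne_zero).1 h2

/-- Norm continuity, from continuity of the overlaps and `‖|α⟩‖ = 1`. -/
theorem continuous_coherent : Continuous (coherent : (ι → ℂ) → Fock ι) := by
  rw [continuous_iff_continuousAt]
  intro β
  rw [ContinuousAt, tendsto_iff_norm_sub_tendsto_zero]
  have h : ∀ α : ι → ℂ, ‖coherent α - coherent β‖ =
      √(2 - 2 * (⟪coherent α, coherent β⟫_ℂ).re) := fun α => by
    rw [← Real.sqrt_sq (norm_nonneg (coherent α - coherent β)), @norm_sub_sq ℂ, norm_coherent,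
      norm_coherent]
    congr 1
    simp only [RCLike.re_to_complex]
    ring
  simp_rw [h, inner_coherent]
  have hc : Continuous fun α : ι → ℂ => √(2 - 2 * (∏ j, ((Real.exp (-‖α j‖ ^ 2 / 2) : ℂ) *
      (Real.exp (-‖β j‖ ^ 2 / 2) : ℂ) * Complex.exp (starRingEnd ℂ (α j) * β j))).re) := by
    have : Continuous (starRingEnd ℂ) := Complex.continuous_conj
    have : ∀ j, Continuous fun α : ι → ℂ => starRingEnd ℂ (α j) := fun j =>
      this.comp (continuous_apply j)
    fun_prop
  have h0 := hc.tendsto β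
  rw [← inner_coherent, inner_self_eq_norm_sq_to_K, norm_coherent] at h0
  simpa using h0

theorem continuous_rankOne_self {H : Type*} [NormedAddCommGroup H] [InnerProductSpace ℂ H] :
    Continuous fun ψ : H => InnerProductSpace.rankOne ℂ ψ ψ := by
  have h1 : Continuous fun ψ : H => ContinuousLinearMap.smulRightL ℂ H H (innerSL ℂ ψ) ψ :=
    ((ContinuousLinearMap.continuous _).comp (innerSL ℂ).continuous).clm_apply continuous_id
  exact h1

theorem continuous_ketbra_coherent :
    Continuous fun α : ι → ℂ => ketbra (coherent α) :=
  continuous_rankOne_self.comp continuous_coherent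

theorem annihilation_coherent [DecidableEq ι] (j : ι) (α : ι → ℂ) (n : ι → ℕ) :
    annihilation j (coherent α) n = α j * coherent α n := by
  rw [annihilation, coherent_apply, coherent_apply, ← Finset.mul_prod_erase _ _ (Finset.mem_univ j),
    ← Finset.mul_prod_erase _ _ (Finset.mem_univ j)]
  have h1 : ∀ i ∈ Finset.univ.erase j, (n + Pi.single j 1 : ι → ℕ) i = n i := fun i hi => by
    simp [Finset.ne_of_mem_erase hi]
  have h5 : ∏ i ∈ Finset.univ.erase j, ((Real.exp (-‖α i‖ ^ 2 / 2) : ℂ) *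
        α i ^ (n + Pi.single j 1 : ι → ℕ) i /
          (√(((n + Pi.single j 1 : ι → ℕ) i).factorial : ℝ) : ℂ)) =
      ∏ i ∈ Finset.univ.erase j, ((Real.exp (-‖α i‖ ^ 2 / 2) : ℂ) *
        α i ^ n i / (√((n i).factorial : ℝ) : ℂ)) :=
    Finset.prod_congr rfl fun i hi => by rw [h1 i hi]
  rw [h5]
  simp only [Pi.add_apply, Pi.single_eq_same]
  have h2 : (√((n j + 1).factorial : ℝ) : ℂ) =
      (√((n j : ℝ) + 1) : ℂ) * (√((n j).factorial : ℝ) : ℂ) := by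
    rw [Nat.factorial_succ, Nat.cast_mul, Real.sqrt_mul (by positivity)]
    push_cast
    rfl
  have h3 : (√((n j : ℝ) + 1) : ℂ) ≠ 0 := by
    rw [Complex.ofReal_ne_zero]
    positivity
  have h4 : (√((n j).factorial : ℝ) : ℂ) ≠ 0 := by
    rw [Complex.ofReal_ne_zero]
    positivity
  rw [h2, pow_succ]
  field_simp
  ring

theorem modeDefect_coherent [DecidableEq ι] (c : ℂ) (j : ι) (α : ι → ℂ) :
    modeDefect c j (coherent α) = ‖α j - c‖ₑ ^ 2 := by
  simp_rw [modeDefect, annihilation_coherent, ← sub_mul, enorm_mul, mul_pow]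
  rw [ENNReal.tsum_mul_left, ← enorm_sq_eq, ← ofReal_norm_sq (coherent α), norm_coherent]
  simp

end Coherent

/-! ### Mixtures of coherent states -/

theorem modeDefect_eq_tsum_inner {ι : Type*} [DecidableEq ι] (c : ℂ) (j : ι) (ψ : Fock ι) :
    modeDefect c j ψ = ∑' n : ι → ℕ, ‖⟪(√((n j : ℝ) + 1) : ℂ) • basisVec (n + Pi.single j 1) -
      starRingEnd ℂ c • basisVec n, ψ⟫_ℂ‖ₑ ^ 2 := by
  refine tsum_congr fun n => ?_
  rw [inner_sub_left, inner_smul_left, inner_smul_left, inner_basisVec_left, inner_basisVec_left,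
    Complex.conj_ofReal, Complex.conj_conj]
  rfl

section Mixture

variable {ι : Type*} [Fintype ι]

/-- The mixture `∫ |α⟩⟨α| dμ(α)` of coherent states. -/
def mixture (μ : Measure (ι → ℂ)) : FockOp ι := ∫ α, ketbra (coherent α) ∂μ

theorem integrable_ketbra_coherent (μ : Measure (ι → ℂ)) [IsFiniteMeasure μ] :
    Integrable (fun α => ketbra (coherent α)) μ :=
  Integrable.of_bound continuous_ketbra_coherent.aestronglyMeasurable 1
    (Eventually.of_forall fun α => by rw [norm_ketbra, norm_coherent, one_pow])

theorem integral_inner_apply {H Ω : Type*} [NormedAddCommGroup H] [InnerProductSpace ℂ H]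
    [CompleteSpace H] [MeasurableSpace Ω] {μ : Measure Ω} {f : Ω → H →L[ℂ] H} (hf : Integrable f μ)
    (w w' : H) : ⟪w, (∫ x, f x ∂μ) w'⟫_ℂ = ∫ x, ⟪w, f x w'⟫_ℂ ∂μ := by
  have h := ((innerSL ℂ w).comp (ContinuousLinearMap.apply ℂ H w')).integral_comp_comm hf
  exact h.symm

theorem inner_mixture (μ : Measure (ι → ℂ)) [IsFiniteMeasure μ] (w w' : Fock ι) :
    ⟪w, mixture μ w'⟫_ℂ = ∫ α, ⟪w, coherent α⟫_ℂ * ⟪coherent α, w'⟫_ℂ ∂μ := by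
  refine (integral_inner_apply (integrable_ketbra_coherent μ) w w').trans ?_
  simp_rw [ketbra_apply, inner_smul_right, mul_comm]

theorem inner_mixture_self (μ : Measure (ι → ℂ)) [IsFiniteMeasure μ] (w : Fock ι) :
    ⟪w, mixture μ w⟫_ℂ = ((∫ α, ‖⟪w, coherent α⟫_ℂ‖ ^ 2 ∂μ : ℝ) : ℂ) := by
  rw [inner_mixture, ← integral_complex_ofReal]
  congr 1
  funext α
  rw [← inner_conj_symm (coherent α) w, Complex.mul_conj, Complex.normSq_eq_norm_sq]

theorem continuous_inner_coherent (w : Fock ι) :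
    Continuous fun α : ι → ℂ => ⟪w, coherent α⟫_ℂ :=
  continuous_const.inner continuous_coherent

theorem ofReal_inner_mixture (μ : Measure (ι → ℂ)) [IsFiniteMeasure μ] (w : Fock ι) :
    ENNReal.ofReal (⟪w, mixture μ w⟫_ℂ).re = ∫⁻ α, ‖⟪w, coherent α⟫_ℂ‖ₑ ^ 2 ∂μ := by
  have hint : Integrable (fun α => ‖⟪w, coherent α⟫_ℂ‖ ^ 2) μ := by
    refine Integrable.of_bound
      ((continuous_inner_coherent w).norm.pow 2).aestronglyMeasurable (‖w‖ ^ 2)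
      (Eventually.of_forall fun α => ?_)
    rw [Real.norm_of_nonneg (by positivity)]
    refine pow_le_pow_left₀ (norm_nonneg _) ((norm_inner_le_norm _ _).trans_eq ?_) 2
    rw [norm_coherent, mul_one]
  rw [inner_mixture_self, Complex.ofReal_re,
    ofReal_integral_eq_lintegral_ofReal hint (Eventually.of_forall fun α => by positivity)]
  simp_rw [ofReal_norm_sq]

theorem isPositive_mixture (μ : Measure (ι → ℂ)) [IsFiniteMeasure μ] :
    (mixture μ).IsPositive := by
  rw [ContinuousLinearMap.isPositive_iff_complex]
  intro w
  have h : ⟪mixture μ w, w⟫_ℂ = ((∫ α, ‖⟪w, coherent α⟫_ℂ‖ ^ 2 ∂μ : ℝ) : ℂ) := by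
    rw [← inner_conj_symm, inner_mixture_self, Complex.conj_ofReal]
  rw [h]
  simp only [RCLike.re_to_complex, Complex.ofReal_re]
  exact ⟨trivial, integral_nonneg fun _ => by positivity⟩

theorem measurable_enorm_inner_coherent_sq (w : Fock ι) :
    Measurable fun α : ι → ℂ => ‖⟪w, coherent α⟫_ℂ‖ₑ ^ 2 :=
  (continuous_inner_coherent w).measurable.enorm.pow_const 2

/-- Fubini for a mixture: for any ensemble of the mixture and any vectors `w_n`, summing
`|⟨w_n|·⟩|²` over the ensemble is the same as integrating it over the coherent states. -/
theorem IsEnsemble.tsum_tsum_inner_mixture {μ : Measure (ι → ℂ)} [IsFiniteMeasure μ] {β γ : Type*}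
    [Countable γ] {χ : β → Fock ι} (h : IsEnsemble χ (mixture μ)) (w : γ → Fock ι) :
    ∑' b, ∑' n, ‖⟪w n, χ b⟫_ℂ‖ₑ ^ 2 = ∫⁻ α, ∑' n, ‖⟪w n, coherent α⟫_ℂ‖ₑ ^ 2 ∂μ := by
  rw [ENNReal.tsum_comm, lintegral_tsum fun n =>
    (measurable_enorm_inner_coherent_sq _).aemeasurable]
  simp_rw [h.tsum_inner_sq, ofReal_inner_mixture]

theorem IsEnsemble.tsum_norm_sq_mixture {μ : Measure (ι → ℂ)} [IsFiniteMeasure μ] {β : Type*}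
    {χ : β → Fock ι} (h : IsEnsemble χ (mixture μ)) : ∑' b, ‖χ b‖ₑ ^ 2 = μ Set.univ := by
  have := h.tsum_tsum_inner_mixture basisVec
  simp_rw [inner_basisVec_left, ← enorm_sq_eq, ← ofReal_norm_sq (coherent _), norm_coherent] at this
  simpa using this

theorem exists_isEnsemble_mixture (μ : Measure (ι → ℂ)) [IsFiniteMeasure μ] :
    ∃ χ : (ι → ℕ) → Fock ι, IsEnsemble χ (mixture μ) := by
  refine exists_isEnsemble_of_isPositive (isPositive_mixture μ) ?_
  have h : ∑' x : ι → ℕ, ENNReal.ofReal (⟪basisVec x, mixture μ (basisVec x)⟫_ℂ).re ≠ ⊤ := by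
    simp_rw [ofReal_inner_mixture]
    rw [← lintegral_tsum fun n => (measurable_enorm_inner_coherent_sq _).aemeasurable]
    simp_rw [inner_basisVec_left, ← enorm_sq_eq, ← ofReal_norm_sq, norm_coherent]
    simp
  refine (ENNReal.summable_toReal h).congr fun x => ?_
  rw [ENNReal.toReal_ofReal]
  exact (isPositive_mixture μ).re_inner_nonneg_right _

variable [DecidableEq ι]

theorem IsEnsemble.tsum_modeDefect_mixture {μ : Measure (ι → ℂ)} [IsFiniteMeasure μ] {β : Type*}
    {χ : β → Fock ι} (h : IsEnsemble χ (mixture μ)) (c : ℂ) (j : ι) :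
    ∑' b, modeDefect c j (χ b) = ∫⁻ α, ‖α j - c‖ₑ ^ 2 ∂μ := by
  simp_rw [← modeDefect_coherent c j, modeDefect_eq_tsum_inner]
  exact h.tsum_tsum_inner_mixture _

/-- A classical state has countable ensembles of arbitrarily small centred second moment. They are
obtained by cutting the phase space into small cells: any ensemble of the part of the mixture in a
cell has small second moment around a point of this cell. -/
theorem IsClassical.exists_isEnsemble {σ : FockOp ι} (hσ : IsClassical σ) {ε : ℝ≥0∞} (hε : ε ≠ 0) :
    ∃ (χ : ℕ × (ι → ℕ) → Fock ι) (c : ℕ × (ι → ℕ) → ι → ℂ), IsEnsemble χ σ ∧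
      ∑' b, ‖χ b‖ₑ ^ 2 = 1 ∧ ∑' b, defect (c b) (χ b) ≤ ε := by
  obtain ⟨μ, hμ, rfl⟩ := hσ
  obtain ⟨δ, hδ0, hδ⟩ : ∃ δ : ℝ, 0 < δ ∧ Fintype.card ι * ENNReal.ofReal δ ^ 2 ≤ ε := by
    have h : Tendsto (fun δ : ℝ => (Fintype.card ι : ℝ≥0∞) * ENNReal.ofReal δ ^ 2) (𝓝[>] 0)
        (𝓝 (Fintype.card ι * ENNReal.ofReal 0 ^ 2)) := by
      refine Tendsto.mono_left ?_ nhdsWithin_le_nhds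
      refine ENNReal.Tendsto.const_mul ?_ (Or.inr (by simp))
      exact ((ENNReal.continuous_pow 2).comp ENNReal.continuous_ofReal).tendsto 0
    rw [ENNReal.ofReal_zero, zero_pow two_ne_zero, mul_zero] at h
    have h1 := (h.eventually (gt_mem_nhds (pos_iff_ne_zero.2 hε))).and self_mem_nhdsWithin
    obtain ⟨δ, h2, h3⟩ := h1.exists
    exact ⟨δ, h3, h2.le⟩
  obtain ⟨A, hAm, hAb, hAd, hAU, hAdisj⟩ :=
    SeparableSpace.exists_measurable_partition_diam_le (ι → ℂ) hδ0
  choose χ hχ using fun k => exists_isEnsemble_mixture (μ.restrict (A k))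
  have hc : ∀ k, ∃ c : ι → ℂ, ∀ α ∈ A k, ∀ j, ‖α j - c j‖ₑ ≤ ENNReal.ofReal δ := fun k => by
    rcases (A k).eq_empty_or_nonempty with h | ⟨c, hc⟩
    · exact ⟨0, fun α hα => by simp [h] at hα⟩
    · refine ⟨c, fun α hα j => ?_⟩
      rw [← ofReal_norm, ← dist_eq_norm]
      refine ENNReal.ofReal_le_ofReal ((dist_le_pi_dist α c j).trans ?_)
      exact (Metric.dist_le_diam_of_mem (hAb k) hα hc).trans (hAd k)
  choose c hc using hc
  have hsum : ∑' k, μ (A k) = 1 := by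
    rw [← measure_iUnion hAdisj hAm, hAU, measure_univ]
  have hT : HasSum (fun k => mixture (μ.restrict (A k))) (mixture μ) := by
    have h := hasSum_integral_iUnion hAm hAdisj
      (integrable_ketbra_coherent (μ.restrict (⋃ k, A k)))
    rw [hAU, Measure.restrict_univ] at h
    exact h
  have hnorm : ∑' q : ℕ × (ι → ℕ), ‖χ q.1 q.2‖ₑ ^ 2 = 1 := by
    rw [ENNReal.tsum_prod (f := fun k n => ‖χ k n‖ₑ ^ 2)]
    simp_rw [(hχ _).tsum_norm_sq_mixture, Measure.restrict_apply_univ]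
    exact hsum
  have hens := IsEnsemble.hasSum_prod hχ (summable_norm_sq_iff.2 (by simp [hnorm]))
  rw [hT.tsum_eq] at hens
  refine ⟨fun q => χ q.1 q.2, fun q => c q.1, hens.2, hnorm, le_trans ?_ hδ⟩
  rw [ENNReal.tsum_prod (f := fun k n => defect (c k) (χ k n))]
  calc ∑' k, ∑' n, defect (c k) (χ k n)
      = ∑' k, ∑ j, ∫⁻ α in A k, ‖α j - c k j‖ₑ ^ 2 ∂μ := by
        refine tsum_congr fun k => ?_
        simp only [defect]
        rw [Summable.tsum_finsetSum fun _ _ => ENNReal.summable]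
        simp_rw [(hχ k).tsum_modeDefect_mixture]
    _ ≤ ∑' k, ∑ _j : ι, ENNReal.ofReal δ ^ 2 * μ (A k) := by
        refine ENNReal.tsum_le_tsum fun k => Finset.sum_le_sum fun j _ => ?_
        refine (setLIntegral_mono' (hAm k) (g := fun _ => ENNReal.ofReal δ ^ 2)
          fun α hα => ?_).trans_eq (setLIntegral_const _ _)
        exact pow_le_pow_left₀ (zero_le) (hc k α hα j) 2
    _ = Fintype.card ι * ENNReal.ofReal δ ^ 2 := by
        simp only [Finset.sum_const, Finset.card_univ, nsmul_eq_mul]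
        rw [ENNReal.tsum_mul_left, ENNReal.tsum_mul_left, hsum, mul_one]

end Mixture

theorem IsClassical.Q_eq_zero {ι : Type*} [Fintype ι] [DecidableEq ι] [Nonempty ι] {ρ : FockOp ι}
    (h : IsClassical ρ) : Q ρ = 0 := by
  refine le_antisymm (ENNReal.le_of_forall_pos_le_add fun ε hε _ => ?_) (zero_le)
  have hcard : (Fintype.card ι : ℝ≥0∞) ≠ 0 := by simp
  obtain ⟨χ, c, hχ, hn, hd⟩ := h.exists_isEnsemble
    (ε := Fintype.card ι / 2 * ε) (by simp [hε.ne', ENNReal.div_eq_zero_iff])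
  refine (hχ.Q_le hn c).trans ((mul_le_mul_right hd _).trans_eq ?_)
  rw [← mul_assoc, zero_add]
  have : (2 : ℝ≥0∞) / Fintype.card ι * (Fintype.card ι / 2) = 1 := by
    rw [← ENNReal.inv_div (by simp) (by simp)]
    exact ENNReal.inv_mul_cancel (by simp) (ENNReal.div_ne_top (by simp) (by simp))
  rw [this, one_mul]

/-! ### Weak limits of ensembles of almost coherent states -/

section Limit

theorem op_ext_basisVec {X : Type*} {S T : Op X}
    (h : ∀ x y, ⟪basisVec x, S (basisVec y)⟫_ℂ = ⟪basisVec x, T (basisVec y)⟫_ℂ) : S = T := by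
  classical
  have h1 : ∀ y, S (basisVec y) = T (basisVec y) := fun y => by
    ext x
    simpa only [inner_basisVec_left] using h x y
  ext1 ψ
  have h2 := lp.hasSum_single (E := fun _ : X => ℂ) (p := 2) (by norm_num) ψ
  have h3 : ∀ x, lp.single (E := fun _ : X => ℂ) 2 x (ψ x) = ψ x • basisVec x := fun x => by
    rw [basisVec, ← lp.single_smul]
    simp
  simp_rw [h3] at h2
  refine (h2.mapL S).unique ?_
  have h4 := h2.mapL T
  simpa only [map_smul, h1] using h4

variable {ι : Type*} [Fintype ι] [DecidableEq ι]

theorem coherent_zero_ne_zero {ι : Type*} [Fintype ι] (α : ι → ℂ) : coherent α 0 ≠ 0 := by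
  rw [coherent_apply, Finset.prod_ne_zero_iff]
  intro j _
  simp

/-- The joint eigenvectors of the annihilation operators are the multiples of coherent states. -/
theorem eq_mul_coherent {f : (ι → ℕ) → ℂ} {α : ι → ℂ}
    (h : ∀ j n, annihilation j f n = α j * f n) (n : ι → ℕ) :
    f n = f 0 / coherent α 0 * coherent α n := by
  have h0 := coherent_zero_ne_zero α
  generalize hk : ∑ j, n j = k
  induction k generalizing n with
  | zero =>
    have : n = 0 := funext fun j => (Finset.sum_eq_zero_iff.1 hk) j (Finset.mem_univ j)
    rw [this]
    field_simp
  | succ k ih =>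
    obtain ⟨j, hj⟩ : ∃ j, n j ≠ 0 := by
      by_contra! hne
      simp [hne] at hk
    obtain ⟨m, rfl⟩ : ∃ m : ι → ℕ, n = m + Pi.single j 1 := by
      refine ⟨n - Pi.single j 1, funext fun i => ?_⟩
      rcases eq_or_ne i j with rfl | hij
      · simp; omega
      · simp [hij]
    have hm : ∑ i, m i = k := by
      simp only [Pi.add_apply, Finset.sum_add_distrib, Finset.sum_pi_single', Finset.mem_univ,
        if_true] at hk
      simpa using hk
    have h1 := h j m
    have h2 := annihilation_coherent j α m
    rw [annihilation] at h1 h2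
    have h3 : (√((m j : ℝ) + 1) : ℂ) ≠ 0 := by
      rw [Complex.ofReal_ne_zero]
      positivity
    refine mul_left_cancel₀ h3 ?_
    rw [h1, mul_left_comm, h2, ih m hm]
    ring

/-- The closed unit disc. -/
abbrev Disc := Metric.closedBall (0 : ℂ) 1

/-- A compact space containing the pairs of a unit vector `ψ` (given by its coefficients, in the
topology of pointwise convergence) and a point `c` of phase space. The latter is encoded by
`s = 1 / (1 + ∑ |c_j|)` and `β_j = s c_j`, so that `s = 0` are the points at infinity. -/
abbrev Pointed (ι : Type*) := ((ι → ℕ) → Disc) × (ι → Disc) × Set.Icc (0 : ℝ) 1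

theorem one_add_sum_norm_pos {ι : Type*} [Fintype ι] (c : ι → ℂ) : 0 < 1 + ∑ j, ‖c j‖ := by
  positivity

/-- The point of the compact space given by a unit vector and a point of phase space. -/
def pointed {ι : Type*} [Fintype ι] (ψ : Fock ι) (hψ : ‖ψ‖ = 1) (c : ι → ℂ) : Pointed ι :=
  (fun n => ⟨ψ n, by
      rw [mem_closedBall_zero_iff, ← hψ]
      exact lp.norm_apply_le_norm two_ne_zero ψ n⟩,
    fun j => ⟨((1 + ∑ j, ‖c j‖)⁻¹ : ℝ) * c j, by
      rw [mem_closedBall_zero_iff, norm_mul, Complex.norm_real, norm_inv,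
        Real.norm_of_nonneg (one_add_sum_norm_pos c).le, inv_mul_le_one₀ (one_add_sum_norm_pos c)]
      have := Finset.single_le_sum (f := fun j => ‖c j‖) (fun _ _ => norm_nonneg _)
        (Finset.mem_univ j)
      linarith⟩,
    ⟨(1 + ∑ j, ‖c j‖)⁻¹, by
      have : 0 ≤ ∑ j, ‖c j‖ := Finset.sum_nonneg fun _ _ => norm_nonneg _
      exact ⟨by positivity, inv_le_one_of_one_le₀ (by linarith)⟩⟩)

/-- The point of phase space encoded by a point of the compact space with `s ≠ 0`. -/
def phase {ι : Type*} (z : Pointed ι) : ι → ℂ := fun j => z.2.1 j / ((z.2.2 : ℝ) : ℂ)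

theorem measurable_phase {ι : Type*} [Finite ι] : Measurable (phase : Pointed ι → ι → ℂ) := by
  refine measurable_pi_iff.2 fun j => ?_
  have h1 : Continuous fun z : Pointed ι => (z.2.1 j : ℂ) := by fun_prop
  have h2 : Continuous fun z : Pointed ι => ((z.2.2 : ℝ) : ℂ) := by fun_prop
  exact h1.measurable.div h2.measurable

/-- The discrete measure with weights `p i` at the points `z i`. -/
def discreteMeasure {Z : Type*} [MeasurableSpace Z] (p : ℕ → ℝ≥0) (z : ℕ → Z) : Measure Z :=
  Measure.sum fun i => p i • Measure.dirac (z i)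

theorem isProbabilityMeasure_discreteMeasure {Z : Type*} [MeasurableSpace Z] {p : ℕ → ℝ≥0}
    (hp : HasSum p 1) (z : ℕ → Z) : IsProbabilityMeasure (discreteMeasure p z) := by
  constructor
  rw [discreteMeasure, Measure.sum_apply _ MeasurableSet.univ]
  simp only [Measure.smul_apply, measure_univ]
  have h : ∑' i, (p i : ℝ≥0∞) = 1 := by
    rw [← ENNReal.coe_tsum hp.summable, hp.tsum_eq, ENNReal.coe_one]
  simpa [ENNReal.smul_def] using h

theorem lintegral_discreteMeasure {Z : Type*} [MeasurableSpace Z] (p : ℕ → ℝ≥0) (z : ℕ → Z)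
    {f : Z → ℝ≥0∞} (hf : Measurable f) :
    ∫⁻ x, f x ∂(discreteMeasure p z) = ∑' i, (p i : ℝ≥0∞) * f (z i) := by
  rw [discreteMeasure, lintegral_sum_measure]
  refine tsum_congr fun i => ?_
  rw [lintegral_smul_measure, lintegral_dirac' _ hf]
  rfl

theorem hasSum_integral_discreteMeasure {Z : Type*} [TopologicalSpace Z] [CompactSpace Z]
    [MeasurableSpace Z] [BorelSpace Z] {p : ℕ → ℝ≥0} (hp : HasSum p 1) (z : ℕ → Z) {f : Z → ℂ}
    (hf : Continuous f) :
    HasSum (fun i => ((p i : ℝ) : ℂ) * f (z i)) (∫ x, f x ∂(discreteMeasure p z)) := by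
  have := isProbabilityMeasure_discreteMeasure hp z
  have hint : Integrable f (discreteMeasure p z) := by
    refine hf.integrable_of_hasCompactSupport ?_
    exact HasCompactSupport.of_compactSpace f
  have h := hasSum_integral_measure hint
  have h2 : ∀ i, ∫ x, f x ∂(p i • Measure.dirac (z i)) = ((p i : ℝ) : ℂ) * f (z i) := fun i => by
    rw [integral_smul_nnreal_measure, integral_dirac' _ _ hf.stronglyMeasurable]
    rfl
  simp_rw [h2] at h
  exact h

/-- A limit of probability measures on a compact space annihilates every nonnegative continuous
function whose integrals tend to zero. -/
theorem ae_eq_zero_of_tendsto {Z : Type*} [TopologicalSpace Z] [CompactSpace Z] [T2Space Z]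
    [MeasurableSpace Z] [BorelSpace Z] {F : Filter ℕ} [F.NeBot] {νs : ℕ → ProbabilityMeasure Z}
    {ν : ProbabilityMeasure Z} (h : Tendsto νs F (𝓝 ν)) {f : Z → ℝ} (hf : Continuous f)
    (hf0 : ∀ z, 0 ≤ f z)
    (hlim : Tendsto (fun n => ∫⁻ z, ENNReal.ofReal (f z) ∂(νs n : Measure Z)) F (𝓝 0)) :
    ∀ᵐ z ∂(ν : Measure Z), f z = 0 := by
  have hint : ∀ μ : ProbabilityMeasure Z, Integrable f (μ : Measure Z) := fun μ =>
    hf.integrable_of_hasCompactSupport (HasCompactSupport.of_compactSpace f)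
  have h1 := ProbabilityMeasure.tendsto_iff_forall_integral_tendsto.1 h
    (BoundedContinuousFunction.mkOfCompact ⟨f, hf⟩)
  simp only [BoundedContinuousFunction.mkOfCompact_apply, ContinuousMap.coe_mk] at h1
  have h2 : ∀ μ : ProbabilityMeasure Z, ∫ z, f z ∂(μ : Measure Z) =
      (∫⁻ z, ENNReal.ofReal (f z) ∂(μ : Measure Z)).toReal := fun μ =>
    integral_eq_lintegral_of_nonneg_ae (Eventually.of_forall hf0) (hint μ).1
  have h3 : Tendsto (fun n => ∫ z, f z ∂(νs n : Measure Z)) F (𝓝 0) := by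
    simp_rw [h2]
    exact (ENNReal.tendsto_toReal ENNReal.zero_ne_top).comp hlim
  have h4 := tendsto_nhds_unique h1 h3
  exact (integral_eq_zero_iff_of_nonneg hf0 (hint ν)).1 h4

theorem integral_eq_of_tendsto {Z : Type*} [TopologicalSpace Z] [CompactSpace Z] [T2Space Z]
    [MeasurableSpace Z] [BorelSpace Z] {F : Filter ℕ} [F.NeBot] {νs : ℕ → ProbabilityMeasure Z}
    {ν : ProbabilityMeasure Z} (h : Tendsto νs F (𝓝 ν)) {f : Z → ℂ} (hf : Continuous f) {L : ℂ}
    (hL : ∀ n, ∫ z, f z ∂(νs n : Measure Z) = L) : ∫ z, f z ∂(ν : Measure Z) = L := by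
  have hint : ∀ μ : ProbabilityMeasure Z, Integrable f (μ : Measure Z) := fun μ =>
    hf.integrable_of_hasCompactSupport (HasCompactSupport.of_compactSpace f)
  have key : ∀ g : ℂ →L[ℝ] ℝ, g (∫ z, f z ∂(ν : Measure Z)) = g L := fun g => by
    have h1 := ProbabilityMeasure.tendsto_iff_forall_integral_tendsto.1 h
      (BoundedContinuousFunction.mkOfCompact ⟨fun z => g (f z), g.continuous.comp hf⟩)
    simp only [BoundedContinuousFunction.mkOfCompact_apply, ContinuousMap.coe_mk] at h1
    simp_rw [g.integral_comp_comm (hint _), hL] at h1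
    exact tendsto_nhds_unique h1 tendsto_const_nhds
  exact Complex.ext (key Complex.reCLM) (key Complex.imCLM)

theorem IsPureDecomposition.hasSum_inner_basisVec {X : Type*} {p : ℕ → ℝ≥0} {ψ : ℕ → L2 X}
    {ρ : Op X} (h : IsPureDecomposition p ψ ρ) (x y : X) :
    HasSum (fun i => ((p i : ℝ) : ℂ) * (ψ i x * starRingEnd ℂ (ψ i y)))
      ⟪basisVec x, ρ (basisVec y)⟫_ℂ := by
  have h1 := h.isEnsemble.hasSum_inner (basisVec x) (basisVec y)
  have h2 : ∀ i, ⟪basisVec x, ((√(p i) : ℝ) : ℂ) • ψ i⟫_ℂ *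
      ⟪((√(p i) : ℝ) : ℂ) • ψ i, basisVec y⟫_ℂ =
      ((p i : ℝ) : ℂ) * (ψ i x * starRingEnd ℂ (ψ i y)) := fun i => by
    have h3 : ((√(p i) : ℝ) : ℂ) * ((√(p i) : ℝ) : ℂ) = ((p i : ℝ) : ℂ) := by
      rw [← Complex.ofReal_mul, Real.mul_self_sqrt (NNReal.coe_nonneg _)]
    rw [inner_smul_left, inner_smul_right, inner_basisVec_left, ← inner_conj_symm (ψ i),
      inner_basisVec_left, Complex.conj_ofReal, ← h3]
    ring
  simp_rw [h2] at h1
  exact h1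

/-- A unit vector `ψ` which is an eigenvector of the annihilation operators, possibly with
eigenvalues at infinity, is a coherent state up to a phase. -/
theorem mul_conj_eq_of_eigenvector {z : Pointed ι}
    (ha : ∀ j (n : ι → ℕ), ((z.2.2 : ℝ) : ℂ) * annihilation j (fun m => (z.1 m : ℂ)) n =
      z.2.1 j * z.1 n)
    (hs : (z.2.2 : ℝ) + ∑ j, ‖(z.2.1 j : ℂ)‖ = 1) (h1 : ∑' n, ‖(z.1 n : ℂ)‖ₑ ^ 2 = 1)
    (n m : ι → ℕ) : (z.1 n : ℂ) * starRingEnd ℂ (z.1 m) =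
      coherent (phase z) n * starRingEnd ℂ (coherent (phase z) m) := by
  have hs0 : ((z.2.2 : ℝ) : ℂ) ≠ 0 := by
    intro h0
    -- at infinity some `β_j` is nonzero, so that all coefficients of `ψ` vanish.
    have hs' : (z.2.2 : ℝ) = 0 := by exact_mod_cast h0
    obtain ⟨j, hj⟩ : ∃ j, (z.2.1 j : ℂ) ≠ 0 := by
      by_contra! hne
      simp [hs', hne] at hs
    have hz : ∀ n, (z.1 n : ℂ) = 0 := fun n => by
      have := ha j n
      rw [h0, zero_mul] at this
      exact (mul_eq_zero.1 this.symm).resolve_left hj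
    simp [hz] at h1
  have h2 : ∀ j n, annihilation j (fun m => (z.1 m : ℂ)) n = phase z j * z.1 n := fun j n => by
    rw [phase, div_mul_eq_mul_div, eq_div_iff hs0, ← ha, mul_comm]
  have h3 := eq_mul_coherent h2
  set γ := (z.1 0 : ℂ) / coherent (phase z) 0
  have h4 : ‖γ‖ₑ ^ 2 = 1 := by
    have h5 : ∑' n, ‖(z.1 n : ℂ)‖ₑ ^ 2 = ‖γ‖ₑ ^ 2 := by
      simp_rw [h3, enorm_mul, mul_pow]
      rw [ENNReal.tsum_mul_left, ← enorm_sq_eq, ← ofReal_norm_sq (coherent _), norm_coherent]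
      simp
    rw [← h5, h1]
  have h6 : γ * starRingEnd ℂ γ = 1 := by
    rw [← ofReal_norm_sq, ENNReal.ofReal_eq_one] at h4
    rw [Complex.mul_conj, Complex.normSq_eq_norm_sq, h4, Complex.ofReal_one]
  rw [h3 n, h3 m, map_mul]
  linear_combination (coherent (phase z) n * starRingEnd ℂ (coherent (phase z) m)) * h6

theorem ofReal_pointed_defect_le {ψ : Fock ι} (hψ : ‖ψ‖ = 1) (c : ι → ℂ) (j : ι) (n : ι → ℕ) :
    ENNReal.ofReal (‖(((pointed ψ hψ c).2.2 : ℝ) : ℂ) *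
      annihilation j (fun m => ((pointed ψ hψ c).1 m : ℂ)) n -
        (pointed ψ hψ c).2.1 j * (pointed ψ hψ c).1 n‖ ^ 2) ≤ defect c ψ := by
  set s : ℝ := ((pointed ψ hψ c).2.2 : ℝ)
  have hs : ‖(s : ℂ)‖ₑ ≤ 1 := by
    rw [← ofReal_norm, Complex.norm_real, Real.norm_of_nonneg (pointed ψ hψ c).2.2.2.1]
    exact ENNReal.ofReal_le_one.2 (pointed ψ hψ c).2.2.2.2
  have h1 : (s : ℂ) * annihilation j (fun m => ((pointed ψ hψ c).1 m : ℂ)) n -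
      (pointed ψ hψ c).2.1 j * (pointed ψ hψ c).1 n =
      (s : ℂ) * (annihilation j ψ n - c j * ψ n) := by
    rw [mul_sub, ← mul_assoc]
    rfl
  rw [h1, ofReal_norm_sq, enorm_mul, mul_pow]
  calc _ ≤ ‖annihilation j ψ n - c j * ψ n‖ₑ ^ 2 :=
        mul_le_of_le_one_left' (pow_le_one₀ (zero_le) hs)
    _ ≤ modeDefect (c j) j ψ := ENNReal.le_tsum n
    _ ≤ defect c ψ := Finset.single_le_sum (f := fun j => modeDefect (c j) j ψ)
        (fun _ _ => zero_le) (Finset.mem_univ j)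

variable [Nonempty ι]

/-- If `Q ρ = 0`, then `ρ` is classical. Decompositions of `ρ` into pure states of small centred
second moment, with the centres adjoined, form a sequence of probability measures on a compact
space. A limit point is concentrated on coherent states. -/
theorem isClassical_of_Q_eq_zero {ρ : FockOp ι} (hρ : IsDensityOperator ρ) (hQ : Q ρ = 0) :
    IsClassical ρ := by
  have hr : ∀ n : ℕ, Q ρ < 2 / Fintype.card ι * ((n + 1 : ℕ) : ℝ≥0∞)⁻¹ := fun n => by
    rw [hQ]
    exact ENNReal.mul_pos (ENNReal.div_ne_zero.2 ⟨two_ne_zero, ENNReal.natCast_ne_top _⟩)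
      (ENNReal.inv_ne_zero.2 (ENNReal.natCast_ne_top _))
  choose p ψ c hd hlt using fun n => exists_isPureDecomposition_of_Q_lt (hr n)
  have hS : Tendsto (fun n => ∑' i, (p n i : ℝ≥0∞) * defect (c n i) (ψ n i)) atTop (𝓝 0) := by
    refine tendsto_of_tendsto_of_tendsto_of_le_of_le tendsto_const_nhds
      (ENNReal.tendsto_inv_nat_nhds_zero.comp (tendsto_add_atTop_nat 1)) (fun _ => zero_le)
      fun n => (lt_of_mul_lt_mul_left' (hlt n)).le
  set z : ℕ → ℕ → Pointed ι := fun n i => pointed (ψ n i) ((hd n).2.1 i) (c n i)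
  set νs : ℕ → ProbabilityMeasure (Pointed ι) := fun n =>
    ⟨discreteMeasure (p n) (z n), isProbabilityMeasure_discreteMeasure (hd n).1 (z n)⟩
  obtain ⟨ν, -, hν⟩ := isCompact_univ.ultrafilter_le_nhds (Ultrafilter.map νs (hyperfilter ℕ))
    (by simp)
  have hν' : Tendsto νs (hyperfilter ℕ) (𝓝 ν) := hν
  have hψc : ∀ n : ι → ℕ, Continuous fun x : Pointed ι => (x.1 n : ℂ) := fun n => by fun_prop
  -- almost surely the vector is an eigenvector of the annihilation operators
  have ha : ∀ᵐ x ∂(ν : Measure (Pointed ι)), ∀ j (n : ι → ℕ), ((x.2.2 : ℝ) : ℂ) *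
      annihilation j (fun m => (x.1 m : ℂ)) n = x.2.1 j * x.1 n := by
    refine ae_all_iff.2 fun j => ae_all_iff.2 fun n => ?_
    have hf : Continuous fun x : Pointed ι => ‖((x.2.2 : ℝ) : ℂ) *
        annihilation j (fun m => (x.1 m : ℂ)) n - x.2.1 j * x.1 n‖ ^ 2 := by
      unfold annihilation
      fun_prop
    have h := ae_eq_zero_of_tendsto hν' hf (fun _ => by positivity) ?_
    · filter_upwards [h] with x hx
      exact sub_eq_zero.1 (norm_eq_zero.1 (pow_eq_zero_iff two_ne_zero |>.1 hx))
    · refine Tendsto.mono_left ?_ Nat.hyperfilter_le_atTop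
      refine tendsto_of_tendsto_of_tendsto_of_le_of_le tendsto_const_nhds hS (fun _ => zero_le)
        fun k => ?_
      change ∫⁻ x, _ ∂(discreteMeasure (p k) (z k)) ≤ _
      rw [lintegral_discreteMeasure _ _ hf.measurable.ennreal_ofReal]
      exact ENNReal.tsum_le_tsum fun i =>
        mul_le_mul_right (ofReal_pointed_defect_le ((hd k).2.1 i) (c k i) j n) _
  have hzero : ∀ {f : Pointed ι → ℝ}, Continuous f → (∀ x, 0 ≤ f x) → (∀ n i, f (z n i) = 0) →
      ∀ᵐ x ∂(ν : Measure (Pointed ι)), f x = 0 := fun {f} hf hf0 hfz => by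
    refine ae_eq_zero_of_tendsto hν' hf hf0 ?_
    refine tendsto_const_nhds.congr fun k => ?_
    change _ = ∫⁻ x, _ ∂(discreteMeasure (p k) (z k))
    rw [lintegral_discreteMeasure _ _ hf.measurable.ennreal_ofReal]
    simp [hfz]
  have hb : ∀ᵐ x ∂(ν : Measure (Pointed ι)), (x.2.2 : ℝ) + ∑ j, ‖(x.2.1 j : ℂ)‖ = 1 := by
    have h := hzero (f := fun x => |(x.2.2 : ℝ) + ∑ j, ‖(x.2.1 j : ℂ)‖ - 1|) (by fun_prop)
      (fun _ => abs_nonneg _) fun n i => ?_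
    · filter_upwards [h] with x hx
      exact sub_eq_zero.1 (abs_eq_zero.1 hx)
    · have hpos := one_add_sum_norm_pos (c n i)
      simp only [z, pointed, norm_mul, Complex.norm_real, norm_inv, Real.norm_of_nonneg hpos.le]
      rw [← Finset.mul_sum, abs_eq_zero]
      field_simp
      ring
  have hle : ∀ᵐ x ∂(ν : Measure (Pointed ι)), ∑' n, ‖(x.1 n : ℂ)‖ₑ ^ 2 ≤ 1 := by
    have h : ∀ᵐ x ∂(ν : Measure (Pointed ι)), ∀ s : Finset (ι → ℕ),
        max (∑ n ∈ s, ‖(x.1 n : ℂ)‖ ^ 2 - 1) 0 = 0 := by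
      refine ae_all_iff.2 fun s => hzero (f := fun x => max (∑ n ∈ s, ‖(x.1 n : ℂ)‖ ^ 2 - 1) 0)
        (by fun_prop) (fun _ => le_max_right _ _) fun n i => max_eq_right ?_
      have h1 := (summable_sq (ψ n i)).sum_le_tsum s fun _ _ => by positivity
      rw [← norm_sq_eq, (hd n).2.1] at h1
      have h2 : ∑ m ∈ s, ‖((z n i).1 m : ℂ)‖ ^ 2 = ∑ m ∈ s, ‖ψ n i m‖ ^ 2 := rfl
      rw [h2]
      linarith
    filter_upwards [h] with x hx
    rw [ENNReal.tsum_eq_iSup_sum]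
    refine iSup_le fun s => ?_
    have h1 : ∑ n ∈ s, ‖(x.1 n : ℂ)‖ ^ 2 ≤ 1 := by
      have := max_eq_right_iff.1 (hx s)
      linarith
    have h2 := ENNReal.ofReal_le_one.2 h1
    rw [ENNReal.ofReal_sum_of_nonneg fun _ _ => by positivity] at h2
    simpa only [ofReal_norm_sq] using h2
  -- the matrix elements of `ρ` as integrals over the limit measure
  have hint : ∀ n m : ι → ℕ, ∫ x : Pointed ι, (x.1 n : ℂ) * starRingEnd ℂ (x.1 m)
      ∂(ν : Measure (Pointed ι)) = ⟪basisVec n, ρ (basisVec m)⟫_ℂ := fun n m => by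
    have hf : Continuous fun x : Pointed ι => (x.1 n : ℂ) * starRingEnd ℂ (x.1 m) :=
      (hψc n).mul (Complex.continuous_conj.comp (hψc m))
    refine integral_eq_of_tendsto hν' hf fun k => ?_
    exact (hasSum_integral_discreteMeasure (hd k).1 (z k) hf).unique
      ((hd k).hasSum_inner_basisVec n m)
  have hmass : ∫⁻ x : Pointed ι, ∑' n, ‖(x.1 n : ℂ)‖ₑ ^ 2 ∂(ν : Measure (Pointed ι)) = 1 := by
    have hdiag : ∀ n : ι → ℕ, ∫⁻ x : Pointed ι, ‖(x.1 n : ℂ)‖ₑ ^ 2 ∂(ν : Measure (Pointed ι)) =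
        ENNReal.ofReal (⟪basisVec n, ρ (basisVec n)⟫_ℂ).re := fun n => by
      have hi : Integrable (fun x : Pointed ι => ‖(x.1 n : ℂ)‖ ^ 2) (ν : Measure (Pointed ι)) :=
        ((hψc n).norm.pow 2).integrable_of_hasCompactSupport (HasCompactSupport.of_compactSpace _)
      rw [← hint]
      simp_rw [Complex.mul_conj, Complex.normSq_eq_norm_sq, ← ofReal_norm_sq]
      rw [integral_complex_ofReal, Complex.ofReal_re,
        ofReal_integral_eq_lintegral_ofReal hi (Eventually.of_forall fun _ => by positivity)]
    rw [lintegral_tsum fun n => ((hψc n).measurable.enorm.pow_const 2).aemeasurable]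
    simp_rw [hdiag]
    have h1 := Complex.hasSum_re hρ.2
    have h0 : ∀ n : ι → ℕ, 0 ≤ (⟪basisVec n, ρ (basisVec n)⟫_ℂ).re := fun n =>
      hρ.1.re_inner_nonneg_right _
    rw [← ENNReal.ofReal_tsum_of_nonneg h0 h1.summable, h1.tsum_eq]
    simp
  have hone : ∀ᵐ x ∂(ν : Measure (Pointed ι)), ∑' n, ‖(x.1 n : ℂ)‖ₑ ^ 2 = 1 := by
    refine ae_eq_of_ae_le_of_lintegral_le hle ?_ aemeasurable_const ?_
    · rw [hmass]
      exact ENNReal.one_ne_top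
    · rw [hmass]
      simp
  set μ : Measure (ι → ℂ) := (ν : Measure (Pointed ι)).map phase with hμ
  have hμp : IsProbabilityMeasure μ :=
    Measure.isProbabilityMeasure_map measurable_phase.aemeasurable
  refine ⟨μ, hμp, ?_⟩
  change ρ = mixture μ
  refine op_ext_basisVec fun n m => ?_
  rw [← hint, inner_mixture, hμ, integral_map measurable_phase.aemeasurable]
  · refine integral_congr_ae ?_
    filter_upwards [ha, hb, hone] with x hxa hxb hx1
    rw [mul_conj_eq_of_eigenvector hxa hxb hx1, inner_basisVec_left,
      ← inner_conj_symm (coherent _) (basisVec m), inner_basisVec_left]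
  · exact ((continuous_inner_coherent _).mul
      (continuous_coherent.inner continuous_const)).aestronglyMeasurable

end Limit

/-! ### Monotonicity and convexity -/

section Restrict

variable {ι κ Y : Type*} [Fintype ι] [Fintype κ] [DecidableEq ι] [DecidableEq κ]
  {e : (ι → ℕ) ≃ (κ → ℕ) × Y} {i : κ → ι}

theorem IsModeSplitting.tsum_defect_bra_le (h : IsModeSplitting e i) (hi : Function.Injective i)
    (c : ι → ℂ) {β : Type*} {w : β → L2 Y} (hw : Orthonormal ℂ w) (Ψ : Fock ι) :
    ∑' b, defect (fun j => c (i j)) (bra e (w b) Ψ) ≤ defect c Ψ := by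
  simp only [defect]
  rw [Summable.tsum_finsetSum fun _ _ => ENNReal.summable]
  calc _ ≤ ∑ j, modeDefect (c (i j)) (i j) Ψ :=
        Finset.sum_le_sum fun j _ => h.tsum_modeDefect_bra_le _ j hw Ψ
    _ = ∑ k ∈ Finset.univ.map ⟨i, hi⟩, modeDefect (c k) k Ψ := by
        rw [Finset.sum_map]
        rfl
    _ ≤ _ := Finset.sum_le_sum_of_subset (Finset.subset_univ _)

theorem IsModeSplitting.tsum_defect_slice_le (h : IsModeSplitting e i) (hi : Function.Injective i)
    (c : ι → ℂ) (Ψ : Fock ι) : ∑' y, defect (fun j => c (i j)) (slice e y Ψ) ≤ defect c Ψ := by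
  simp_rw [slice_eq_bra]
  exact h.tsum_defect_bra_le hi c orthonormal_basisVec Ψ

end Restrict

theorem tsum_enorm_slice_sq {X Y Z β : Type*} (e : Z ≃ X × Y) (Ψ : β → L2 Z) :
    ∑' q : Y × β, ‖slice e q.1 (Ψ q.2)‖ₑ ^ 2 = ∑' b, ‖Ψ b‖ₑ ^ 2 := by
  rw [ENNReal.tsum_prod (f := fun y b => ‖slice e y (Ψ b)‖ₑ ^ 2), ENNReal.tsum_comm]
  refine tsum_congr fun b => ?_
  have h := sum_norm_slice_sq e (Ψ b)
  rw [← ofReal_tsum_norm_sq h.summable, h.tsum_eq, ofReal_norm_sq]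

section Monotone

variable {A E : Type*} [Fintype A] [DecidableEq A] [Nonempty A] [Fintype E] [DecidableEq E]

/-- A linear optical interaction with a classical ancilla does not increase the total centred
second moment: the moment of a product state is additive, and an ensemble of the ancilla
contributes arbitrarily little. -/
theorem exists_isEnsemble_linearOptical {U : FockOp (A ⊕ E)} (hU : IsLinearOpticalUnitary U)
    {σ : FockOp E} (hσ : IsClassical σ) {ρ : FockOp A} (hρ : IsDensityOperator ρ) {r : ℝ≥0∞}
    (hr : Q ρ < r) :
    ∃ (Ψ : ℕ × (ℕ × (E → ℕ)) → Fock (A ⊕ E)) (c : ℕ × (ℕ × (E → ℕ)) → A ⊕ E → ℂ),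
      IsEnsemble Ψ (U * tensorOp (modeSplit A E) ρ σ * star U) ∧ ∑' b, ‖Ψ b‖ₑ ^ 2 = 1 ∧
        2 / Fintype.card A * ∑' b, defect (c b) (Ψ b) ≤ r := by
  obtain ⟨χ, c₁, hχ, hlt⟩ := exists_isEnsemble_of_Q_lt hr
  have hcard : (Fintype.card A : ℝ≥0∞) / 2 ≠ 0 := by simp [ENNReal.div_eq_zero_iff]
  -- the ancilla may use up the slack left by the ensemble of `ρ`
  obtain ⟨φ, c₂, hφ, hφn, hφd⟩ := hσ.exists_isEnsemble
    (mul_ne_zero hcard (tsub_pos_of_lt hlt).ne')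
  have hχn : ∑' b, ‖χ b‖ₑ ^ 2 = 1 := by
    rw [← ofReal_tsum_norm_sq hχ.summable,
      (hχ.hasSum_norm_sq_of_isDensityOperator hρ).tsum_eq, ENNReal.ofReal_one]
  set c₀ : ℕ × (ℕ × (E → ℕ)) → A ⊕ E → ℂ := fun q => Sum.elim (c₁ q.1) (c₂ q.2)
  set Ψ₀ : ℕ × (ℕ × (E → ℕ)) → Fock (A ⊕ E) := fun q =>
    tensorVec (modeSplit A E) (χ q.1) (φ q.2)
  have hc : ∀ q, ∃ c, defect c (U (Ψ₀ q)) ≤ defect (c₀ q) (Ψ₀ q) := fun q => by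
    by_cases h : defect (c₀ q) (Ψ₀ q) = ⊤
    · exact ⟨0, h ▸ le_top⟩
    · obtain ⟨c, hc⟩ := hU.exists_defect_eq h
      exact ⟨c, hc.le⟩
  choose c hc using hc
  refine ⟨fun q => U (Ψ₀ q), c, (hχ.tensor (modeSplit A E) hφ).map U, ?_, ?_⟩
  · have h1 : ∀ q, ‖U (Ψ₀ q)‖ₑ ^ 2 = ‖χ q.1‖ₑ ^ 2 * ‖φ q.2‖ₑ ^ 2 := fun q => by
      rw [← ofReal_norm_sq, hU.norm_map, norm_tensorVec_sq, ENNReal.ofReal_mul (by positivity),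
        ofReal_norm_sq, ofReal_norm_sq]
    simp_rw [h1]
    rw [ENNReal.tsum_prod (f := fun a b => ‖χ a‖ₑ ^ 2 * ‖φ b‖ₑ ^ 2)]
    simp_rw [ENNReal.tsum_mul_left, hφn, mul_one, hχn]
  · have h2 : ∑' q, defect (c₀ q) (Ψ₀ q) =
        ∑' a, defect (c₁ a) (χ a) + ∑' b, defect (c₂ b) (φ b) := by
      simp only [c₀, Ψ₀, defect_tensorVec, Sum.elim_inl, Sum.elim_inr]
      rw [ENNReal.tsum_prod (f := fun a b =>
        defect (c₁ a) (χ a) * ‖φ b‖ₑ ^ 2 + ‖χ a‖ₑ ^ 2 * defect (c₂ b) (φ b))]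
      simp_rw [ENNReal.tsum_add, ENNReal.tsum_mul_left, hφn, mul_one]
      rw [ENNReal.tsum_mul_right, hχn, one_mul]
    have h3 : (2 : ℝ≥0∞) / Fintype.card A * (Fintype.card A / 2) = 1 := by
      rw [← ENNReal.inv_div (by simp) (by simp)]
      exact ENNReal.inv_mul_cancel hcard (ENNReal.div_ne_top (by simp) (by simp))
    calc _ ≤ 2 / Fintype.card A * ∑' q, defect (c₀ q) (Ψ₀ q) :=
          mul_le_mul_right (ENNReal.tsum_le_tsum hc) _
      _ ≤ 2 / Fintype.card A * (∑' a, defect (c₁ a) (χ a) + Fintype.card A / 2 *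
            (r - 2 / Fintype.card A * ∑' a, defect (c₁ a) (χ a))) := by
          rw [h2]
          exact mul_le_mul_right (add_le_add_right hφd _) _
      _ = r := by
          rw [mul_add, ← mul_assoc (2 / _) (_ / 2), h3, one_mul, add_tsub_cancel_of_le hlt.le]

theorem Q_linearOpticalMap_le {U : FockOp (A ⊕ E)} (hU : IsLinearOpticalUnitary U)
    {σ : FockOp E} (hσ : IsClassical σ) {ρ : FockOp A} (hρ : IsDensityOperator ρ) :
    Q (linearOpticalMap U σ ρ) ≤ Q ρ := by
  refine le_of_forall_gt fun r hr => ?_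
  obtain ⟨r', hr', hr'r⟩ := exists_between hr
  obtain ⟨Ψ, c, hΨ, hn, hd⟩ := exists_isEnsemble_linearOptical hU hσ hρ hr'
  refine lt_of_le_of_lt (le_trans ?_ hd) hr'r
  have h := hΨ.partialTrace (modeSplit A E)
  refine (h.Q_le ((tsum_enorm_slice_sq _ Ψ).trans hn)
    fun q j => c q.2 (Sum.inl j)).trans (mul_le_mul_right ?_ _)
  rw [ENNReal.tsum_prod (f := fun y b =>
    defect (fun j => c b (Sum.inl j)) (slice (modeSplit A E) y (Ψ b))), ENNReal.tsum_comm]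
  exact ENNReal.tsum_le_tsum fun b =>
    (isModeSplitting_modeSplit A E).tsum_defect_slice_le Sum.inl_injective (c b) (Ψ b)

/-- The branch of a selective operation belonging to the outcome `i` is obtained by projecting the
output on the vector `|i⟩`. -/
theorem bra_hasSum_tensorOp {X Y Z κ : Type*} (e : Z ≃ X × Y) {T : κ → Op X} {v : κ → L2 Y}
    (hv : Orthonormal ℂ v) {S : Op Z} (h : HasSum (fun k => tensorOp e (T k) (ketbra (v k))) S)
    (i : κ) : bra e (v i) ∘L S ∘L (bra e (v i)).adjoint = T i := by
  classical
  have h1 := hasSum_sandwich h (bra e (v i)) (bra e (v i)).adjoint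
  simp_rw [bra_tensorOp_ketbra_adjoint] at h1
  have h2 : ∀ k, k ≠ i → (‖⟪v i, v k⟫_ℂ‖ ^ 2 : ℂ) • T k = 0 := fun k hk => by
    rw [hv.2 hk.symm]
    simp
  have h3 := h1.unique (hasSum_single i h2)
  rw [h3, inner_self_eq_norm_sq_to_K, hv.1]
  simp

theorem tsum_outcome_Q_le {κ : Type*} {K : κ → FockOp A} (hK : IsSelectiveLinearOptical K)
    {ρ : FockOp A} (hρ : IsDensityOperator ρ) :
    ∑' i, ENNReal.ofReal (outcomeProb (K i) ρ) * Q (outcomeState (K i) ρ) ≤ Q ρ := by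
  obtain ⟨M', M, U, σ, v, hU, hσ, hv, hK⟩ := hK
  refine le_of_forall_gt fun r hr => ?_
  obtain ⟨r', hr', hr'r⟩ := exists_between hr
  obtain ⟨Ψ, c, hΨ, -, hd⟩ := exists_isEnsemble_linearOptical hU hσ hρ hr'
  refine lt_of_le_of_lt (le_trans ?_ hd) hr'r
  set e := modeSplitAssoc A (Fin M') (Fin M)
  set e' := modeSplit A (Fin M')
  set s : A ⊕ Fin M' → A ⊕ (Fin M' ⊕ Fin M) := fun k => Equiv.sumAssoc A _ _ (Sum.inl k)
  have hΦ := hΨ.partialTrace e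
  set Φ : (Fin M → ℕ) × _ → Fock (A ⊕ Fin M') := fun q => slice e q.1 (Ψ q.2)
  have hi : ∀ i, IsEnsemble (fun q => bra e' (v i) (Φ q)) (K i * ρ * star (K i)) := fun i => by
    have h := hΦ.map (bra e' (v i))
    rwa [bra_hasSum_tensorOp e' hv (hK ρ hρ) i] at h
  have hbound : ∀ i, ENNReal.ofReal (outcomeProb (K i) ρ) * Q (outcomeState (K i) ρ) ≤
      2 / Fintype.card A * ∑' q, defect (fun j => c q.2 (s (Sum.inl j))) (bra e' (v i) (Φ q)) :=
    fun i => by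
      have h := (hi i).mul_Q_le fun q j => c q.2 (s (Sum.inl j))
      have hp : outcomeProb (K i) ρ = ∑' q, ‖bra e' (v i) (Φ q)‖ ^ 2 := by
        rw [outcomeProb, (hi i).trace_eq, Complex.ofReal_re]
      rwa [← hp] at h
  calc _ ≤ ∑' i, 2 / Fintype.card A *
        ∑' q, defect (fun j => c q.2 (s (Sum.inl j))) (bra e' (v i) (Φ q)) :=
        ENNReal.tsum_le_tsum hbound
    _ = 2 / Fintype.card A *
        ∑' q, ∑' i, defect (fun j => c q.2 (s (Sum.inl j))) (bra e' (v i) (Φ q)) := by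
        rw [ENNReal.tsum_mul_left, ENNReal.tsum_comm]
    _ ≤ 2 / Fintype.card A * ∑' q : (Fin M → ℕ) × _, defect (fun k => c q.2 (s k)) (Φ q) := by
        refine mul_le_mul_right (ENNReal.tsum_le_tsum fun q => ?_) _
        exact (isModeSplitting_modeSplit A (Fin M')).tsum_defect_bra_le Sum.inl_injective
          (fun k => c q.2 (s k)) hv (Φ q)
    _ ≤ 2 / Fintype.card A * ∑' b, defect (c b) (Ψ b) := by
        refine mul_le_mul_right ?_ _
        rw [ENNReal.tsum_prod (f := fun y b => defect (fun k => c b (s k)) (slice e y (Ψ b))),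
          ENNReal.tsum_comm]
        refine ENNReal.tsum_le_tsum fun b => ?_
        exact (isModeSplitting_modeSplitAssoc A (Fin M') (Fin M)).tsum_defect_slice_le
          ((Equiv.injective _).comp Sum.inl_injective) (c b) (Ψ b)

theorem Q_tsum_le {κ : Type*} {p : κ → ℝ≥0} {ρ : κ → FockOp A} (hp : HasSum p 1)
    (hρ : ∀ i, IsDensityOperator (ρ i)) :
    Q (∑' i, ((p i : ℝ) : ℂ) • ρ i) ≤ ∑' i, (p i : ℝ≥0∞) * Q (ρ i) := by
  by_cases htop : ∑' i, (p i : ℝ≥0∞) * Q (ρ i) = ⊤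
  · rw [htop]
    exact le_top
  have hp1 : ∑' i, (p i : ℝ≥0∞) = 1 := by
    rw [← ENNReal.coe_tsum hp.summable, hp.tsum_eq, ENNReal.coe_one]
  refine ENNReal.le_of_forall_pos_le_add fun ε hε _ => ?_
  have : Countable (Function.support p) := hp.summable.countable_support_nnreal
  have hfin : ∀ i : Function.support p, Q (ρ i) < Q (ρ i) + ε := fun i => by
    refine ENNReal.lt_add_right (fun h => htop ?_) (by simpa using hε.ne')
    refine ENNReal.tsum_eq_top_of_eq_top ⟨i, ?_⟩
    rw [h]
    exact ENNReal.mul_top (ENNReal.coe_ne_zero.2 (Function.mem_support.1 i.2))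
  choose χ c hχ hlt using fun i => exists_isEnsemble_of_Q_lt (hfin i)
  have hscale : ∀ i : Function.support p, IsEnsemble (fun b => ((√(p i) : ℝ) : ℂ) • χ i b)
      (((p i : ℝ) : ℂ) • ρ i) := fun i => by
    refine ⟨?_, ?_⟩
    · simp_rw [norm_smul, mul_pow]
      exact (hχ i).summable.mul_left _
    · simp_rw [ketbra_smul, Real.sq_sqrt (NNReal.coe_nonneg _)]
      exact (hχ i).hasSum.const_smul _
  have hχn : ∀ i, ∑' b, ‖χ i b‖ₑ ^ 2 = 1 := fun i => by
    rw [← ofReal_tsum_norm_sq (hχ i).summable,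
      ((hχ i).hasSum_norm_sq_of_isDensityOperator (hρ i)).tsum_eq, ENNReal.ofReal_one]
  have hsupp : ∀ F : κ → ℝ≥0∞, ∑' i : Function.support p, (p i : ℝ≥0∞) * F i =
      ∑' i, (p i : ℝ≥0∞) * F i := fun F => by
    refine tsum_subtype_eq_of_support_subset (f := fun i => (p i : ℝ≥0∞) * F i) fun i hi => ?_
    simp only [Function.mem_support] at hi ⊢
    exact fun h => hi (by simp [h])
  have hnorm : ∑' q : Function.support p × ℕ, ‖((√(p q.1) : ℝ) : ℂ) • χ q.1 q.2‖ₑ ^ 2 = 1 := by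
    rw [ENNReal.tsum_prod (f := fun (i : Function.support p) b =>
      ‖((√(p i) : ℝ) : ℂ) • χ i b‖ₑ ^ 2)]
    simp_rw [enorm_smul, mul_pow, enorm_sqrt_coe_sq, ENNReal.tsum_mul_left, hχn]
    rw [hsupp fun _ => 1]
    simpa using hp1
  have hens := (IsEnsemble.hasSum_prod hscale (summable_norm_sq_iff.2 <| by
    rw [hnorm]
    exact ENNReal.one_ne_top)).2
  rw [tsum_subtype_eq_of_support_subset (f := fun i => ((p i : ℝ) : ℂ) • ρ i) fun i hi => by
    simp only [Function.mem_support] at hi ⊢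
    exact fun h => hi (by simp [h])] at hens
  refine (hens.Q_le hnorm fun q => c q.1 q.2).trans ?_
  rw [ENNReal.tsum_prod (f := fun (i : Function.support p) b =>
    defect (c i b) (((√(p i) : ℝ) : ℂ) • χ i b : Fock A)), ← ENNReal.tsum_mul_left]
  calc _ ≤ ∑' i : Function.support p, (p i : ℝ≥0∞) * (Q (ρ i) + ε) := by
        refine ENNReal.tsum_le_tsum fun i => ?_
        simp_rw [defect_smul, enorm_sqrt_coe_sq, ENNReal.tsum_mul_left]
        rw [mul_left_comm]
        exact mul_le_mul_right (hlt i).le _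
    _ = ∑' i, (p i : ℝ≥0∞) * Q (ρ i) + ε := by
        rw [hsupp fun i => Q (ρ i) + ε]
        simp_rw [mul_add]
        rw [ENNReal.tsum_add, ENNReal.tsum_mul_right, hp1, one_mul]

end Monotone

end BosonicModes

end

open BosonicModes in
theorem theorem1 (N : ℕ) (hN : 0 < N) :
    -- `V̄ ≥ 1`, so that the subtraction of `1` in `[0, ∞]` is a true subtraction
    (∀ ρ : FockOp (Fin N), IsDensityOperator ρ → 1 ≤ varianceRoof ρ) ∧
    -- faithfulness
    (∀ ρ : FockOp (Fin N), IsDensityOperator ρ → (Q ρ = 0 ↔ IsClassical ρ)) ∧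
    -- weak monotonicity
    (∀ (M : ℕ) (U : FockOp (Fin N ⊕ Fin M)) (σ : FockOp (Fin M)),
      IsLinearOpticalUnitary U → IsClassical σ →
      ∀ ρ : FockOp (Fin N), IsDensityOperator ρ → Q (linearOpticalMap U σ ρ) ≤ Q ρ) ∧
    -- strong monotonicity
    (∀ (κ : Type) (K : κ → FockOp (Fin N)), IsSelectiveLinearOptical K →
      ∀ ρ : FockOp (Fin N), IsDensityOperator ρ →
        ∑' i, ENNReal.ofReal (outcomeProb (K i) ρ) * Q (outcomeState (K i) ρ) ≤ Q ρ) ∧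
    -- convexity
    (∀ (κ : Type) (p : κ → NNReal) (ρ : κ → FockOp (Fin N)), HasSum p 1 →
      (∀ i, IsDensityOperator (ρ i)) →
        Q (∑' i, ((p i : ℝ) : ℂ) • ρ i) ≤ ∑' i, (p i : ENNReal) * Q (ρ i)) := by
  have : Nonempty (Fin N) := ⟨⟨0, hN⟩⟩
  exact ⟨fun ρ _ => one_le_varianceRoof ρ,
    fun ρ hρ => ⟨isClassical_of_Q_eq_zero hρ, IsClassical.Q_eq_zero⟩,
    fun M U σ hU hσ ρ hρ => Q_linearOpticalMap_le hU hσ hρ,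
    fun κ K hK ρ hρ => tsum_outcome_Q_le hK hρ,
    fun κ p ρ hp hρ => Q_tsum_le hp hρ⟩
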